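/- Let $G$ be a reductive group over $\mathbb{Q}_p$ (a linear algebraic group, not necessarily connected, with trivial unipotent radical), given with a closed embedding $G\subset \mathrm{GL}_n$ over $\mathbb{Q}_p$; put $G(\mathbb{Z}_p)=G(\mathbb{Q}_p)\cap \mathrm{GL}_n(\mathbb{Z}_p)$. Let $T\subset G$ be a non-trivial torus over $\mathbb{Q}_p$, let $H=Z_G(T)$ be its centralizer, and let $K$ be a compact open subgroup of $G(\mathbb{Q}_p)$. Then: (0) $T(\mathbb{Q}_p)$ has a largest compact subgroup $K_T$ (also written $K_T^m$), and for every $g\in G(\mathbb{Q}_p)$ the group $T(\mathbb{Q}_p)\cap g^{-1}Kg$ is a subgroup of finite index of $K_T$. This index depends only on the class of $g$ in $G(\mathbb{Q}_p)/H(\mathbb{Q}_p)$, so $$I(g)=\bigl|K_T/(T(\mathbb{Q}_p)\cap g^{-1}Kg)\bigr|$$ is a well-defined function $G(\mathbb{Q}_p)/H(\mathbb{Q}_p)\to \mathbb{N}$. (1) $I(g)\to\infty$ as $g\to\infty$ in $G(\mathbb{Q}_p)/H(\mathbb{Q}_p)$, where a basis of neighbourhoods of $\infty$ is given by the complements of the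 compact subsets of $G(\mathbb{Q}_p)/H(\mathbb{Q}_p)$ (quotient of the $p$-adic topology). (2) If $W\subset G(\mathbb{Q}_p)/H(\mathbb{Q}_p)$ is a set on which $I$ is bounded, then the image of $W$ in the double coset space $G(\mathbb{Z}_p)\backslash G(\mathbb{Q}_p)/H(\mathbb{Q}_p)$ is finite. -/

import Mathlib

open scoped MatrixGroups

/-- The invertible matrix `g ∈ GL_n(R)` is a zero of all the polynomials in `S`
(polynomials in the matrix entries, with coefficients in `k`). -/
def GLVanishes {k : Type} [CommRing k] {n : ℕ} (S : Set (MvPolynomial (Fin n × Fin n) k))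
    {R : Type} [CommRing R] [Algebra k R] (g : GL (Fin n) R) : Prop :=
  ∀ f ∈ S, MvPolynomial.aeval (fun ij : Fin n × Fin n => g ij.1 ij.2) f = 0

/-- A linear algebraic group over `k`, embedded in `GL_n`: a closed subscheme of `GL_n` over `k`,
cut out by polynomial equations, whose `R`-points form a subgroup of `GL_n(R)` for every
commutative `k`-algebra `R`. -/
structure LinearAlgebraicGroup (k : Type) [Field k] (n : ℕ) where
  /-- the defining equations -/
  eqs : Set (MvPolynomial (Fin n × Fin n) k)
  one_mem : ∀ (R : Type) [CommRing R] [Algebra k R], GLVanishes eqs (1 : GL (Fin n) R)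
  mul_mem : ∀ (R : Type) [CommRing R] [Algebra k R] (g h : GL (Fin n) R),
    GLVanishes eqs g → GLVanishes eqs h → GLVanishes eqs (g * h)
  inv_mem : ∀ (R : Type) [CommRing R] [Algebra k R] (g : GL (Fin n) R),
    GLVanishes eqs g → GLVanishes eqs g⁻¹

namespace LinearAlgebraicGroup

section General

variable {k : Type} [Field k] {n : ℕ}

/-- The group `G(R)`, as a subgroup of `GL_n(R)`. -/
def points (G : LinearAlgebraicGroup k n) (R : Type) [CommRing R] [Algebra k R] :
    Subgroup (GL (Fin n) R) where
  carrier := {g | GLVanishes G.eqs g}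
  one_mem' := G.one_mem R
  mul_mem' := fun {g h} hg hh => G.mul_mem R g h hg hh
  inv_mem' := fun {g} hg => G.inv_mem R g hg

theorem map_mem_points (G : LinearAlgebraicGroup k n) {R S : Type} [CommRing R] [Algebra k R]
    [CommRing S] [Algebra k S] (f : R →ₐ[k] S) {g : GL (Fin n) R} (hg : g ∈ G.points R) :
    Matrix.GeneralLinearGroup.map (f : R →+* S) g ∈ G.points S := by
  intro q hq
  have h := congrArg f (hg q hq)
  rw [map_zero, ← AlgHom.comp_apply, MvPolynomial.comp_aeval] at h
  exact h

/-- The homomorphism `G(R) → G(S)` induced by a homomorphism `R → S` of `k`-algebras. -/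
def pointsMap (G : LinearAlgebraicGroup k n) {R S : Type} [CommRing R] [Algebra k R]
    [CommRing S] [Algebra k S] (f : R →ₐ[k] S) : G.points R →* G.points S :=
  ((Matrix.GeneralLinearGroup.map (f : R →+* S)).comp (G.points R).subtype).codRestrict
    (G.points S) (fun g => G.map_mem_points f g.2)

theorem vanishes_map_iff {K : Type} [Field K] [Algebra k K]
    (S : Set (MvPolynomial (Fin n × Fin n) k)) {R : Type} [CommRing R] [Algebra k R]
    [Algebra K R] [IsScalarTower k K R] (g : GL (Fin n) R) :
    GLVanishes (MvPolynomial.map (algebraMap k K) '' S) g ↔ GLVanishes S g := by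
  unfold GLVanishes
  rw [Set.forall_mem_image]
  simp only [MvPolynomial.aeval_map_algebraMap]

/-- The base change `G_K` of `G` to an extension `K` of `k`. -/
def baseChange (G : LinearAlgebraicGroup k n) (K : Type) [Field K] [Algebra k K] :
    LinearAlgebraicGroup K n where
  eqs := MvPolynomial.map (algebraMap k K) '' G.eqs
  one_mem := fun R _ _ => by
    let _ : Algebra k R := Algebra.compHom R (algebraMap k K)
    have _ : IsScalarTower k K R := IsScalarTower.of_algebraMap_eq fun _ => rfl
    exact (vanishes_map_iff G.eqs _).2 (G.one_mem R)
  mul_mem := fun R _ _ g h hg hh => by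
    let _ : Algebra k R := Algebra.compHom R (algebraMap k K)
    have _ : IsScalarTower k K R := IsScalarTower.of_algebraMap_eq fun _ => rfl
    exact (vanishes_map_iff G.eqs _).2
      (G.mul_mem R g h ((vanishes_map_iff G.eqs _).1 hg) ((vanishes_map_iff G.eqs _).1 hh))
  inv_mem := fun R _ _ g hg => by
    let _ : Algebra k R := Algebra.compHom R (algebraMap k K)
    have _ : IsScalarTower k K R := IsScalarTower.of_algebraMap_eq fun _ => rfl
    exact (vanishes_map_iff G.eqs _).2 (G.inv_mem R g ((vanishes_map_iff G.eqs _).1 hg))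

/-- `U` is a closed subgroup of `G`. -/
def IsSubgroupOf (U G : LinearAlgebraicGroup k n) : Prop :=
  ∀ (R : Type) [CommRing R] [Algebra k R], U.points R ≤ G.points R

/-- `U` is normalised by `G`. -/
def IsNormalizedBy (U G : LinearAlgebraicGroup k n) : Prop :=
  ∀ (R : Type) [CommRing R] [Algebra k R],
    ∀ g ∈ G.points R, ∀ u ∈ U.points R, g * u * g⁻¹ ∈ U.points R

/-- `T` is isomorphic to `𝔾_m^r` over `k` for some `r`: there is an isomorphism of group-valued
functors `T(R) ≃ (Rˣ)^r` on commutative `k`-algebras. -/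
def IsSplitTorus (T : LinearAlgebraicGroup k n) : Prop :=
  ∃ (r : ℕ) (e : ∀ (R : Type) [CommRing R] [Algebra k R], T.points R ≃* (Fin r → Rˣ)),
    ∀ (R S : Type) [CommRing R] [Algebra k R] [CommRing S] [Algebra k S] (f : R →ₐ[k] S)
      (t : T.points R) (i : Fin r),
      e S (T.pointsMap f t) i = Units.map (f : R →* S) (e R t i)

/-- `T` is a torus: it becomes isomorphic to some `𝔾_m^r` over an algebraic closure of `k`. -/
def IsTorus (T : LinearAlgebraicGroup k n) : Prop :=
  (T.baseChange (AlgebraicClosure k)).IsSplitTorus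

/-- Over an algebraically closed field: the set `U(k)` is connected in the Zariski topology, i.e.
it is not the union of two disjoint, nonempty, relatively closed subsets. -/
def IsZariskiConnected (U : LinearAlgebraicGroup k n) : Prop :=
  ∀ S₁ S₂ : Set (MvPolynomial (Fin n × Fin n) k),
    (∀ g ∈ U.points k, GLVanishes S₁ g ∨ GLVanishes S₂ g) →
    (∀ g ∈ U.points k, ¬ (GLVanishes S₁ g ∧ GLVanishes S₂ g)) →
    (∀ g ∈ U.points k, GLVanishes S₁ g) ∨ (∀ g ∈ U.points k, GLVanishes S₂ g)

/-- Over an algebraically closed field of characteristic zero (where algebraic groups are reduced,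
so that `U(k)` determines `U`): all elements of `U(k)` are unipotent matrices. -/
def IsUnipotent (U : LinearAlgebraicGroup k n) : Prop :=
  ∀ u ∈ U.points k, IsNilpotent ((u : Matrix (Fin n) (Fin n) k) - 1)

/-- `G` is reductive: over an algebraic closure, every connected unipotent normal closed subgroup
is trivial, i.e. the unipotent radical of `G` is trivial. (`G` itself may be disconnected.
The base field has characteristic zero, so algebraic groups are reduced and triviality may be
checked on geometric points.) -/
def IsReductive [CharZero k] (G : LinearAlgebraicGroup k n) : Prop :=
  ∀ U : LinearAlgebraicGroup (AlgebraicClosure k) n,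
    U.IsSubgroupOf (G.baseChange (AlgebraicClosure k)) →
    U.IsNormalizedBy (G.baseChange (AlgebraicClosure k)) →
    U.IsZariskiConnected → U.IsUnipotent → U.points (AlgebraicClosure k) = ⊥

/-- `T(k)`, as a subgroup of `G(k)`. -/
def rationalPoints (G T : LinearAlgebraicGroup k n) : Subgroup (G.points k) :=
  (T.points k).subgroupOf (G.points k)

/-- The group `Z_G(T)(k)` of `k`-points of the centralizer of `T` in `G`: the elements of `G(k)`
which commute with `T(R)` for every commutative `k`-algebra `R`. -/
def centralizerPoints (G T : LinearAlgebraicGroup k n) : Subgroup (G.points k) where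
  carrier := {g | ∀ (R : Type) [CommRing R] [Algebra k R], ∀ t ∈ T.points R,
    t * Matrix.GeneralLinearGroup.map (algebraMap k R) (g : GL (Fin n) k) =
      Matrix.GeneralLinearGroup.map (algebraMap k R) (g : GL (Fin n) k) * t}
  one_mem' := fun R _ _ t _ => by simp
  mul_mem' := fun {g h} hg hh R _ _ t ht => by
    rw [Subgroup.coe_mul, map_mul, ← mul_assoc, hg R t ht, mul_assoc, hh R t ht, mul_assoc]
  inv_mem' := fun {g} hg R _ _ t ht => by
    rw [Subgroup.coe_inv, map_inv]
    exact (Commute.inv_right (show Commute t _ from hg R t ht))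

theorem commute_of_mem (G T : LinearAlgebraicGroup k n) {h t : G.points k}
    (hh : h ∈ G.centralizerPoints T) (ht : t ∈ G.rationalPoints T) : t * h = h * t := by
  have hid : Matrix.GeneralLinearGroup.map (algebraMap k k) (h : GL (Fin n) k) = h := by
    ext i j
    simp
  have := hh k t ht
  rw [hid] at this
  exact Subtype.ext this

/-- The subgroup `T(k) ∩ g⁻¹ K g` of `G(k)`. -/
def conjInter (G T : LinearAlgebraicGroup k n) (K : Subgroup (G.points k)) (g : G.points k) :
    Subgroup (G.points k) :=
  G.rationalPoints T ⊓ K.map (MulAut.conj g⁻¹).toMonoidHom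

theorem mem_conjInter (G T : LinearAlgebraicGroup k n) (K : Subgroup (G.points k))
    (g x : G.points k) :
    x ∈ G.conjInter T K g ↔ x ∈ G.rationalPoints T ∧ g * x * g⁻¹ ∈ K := by
  rw [conjInter, Subgroup.mem_inf, Subgroup.mem_map]
  refine and_congr_right fun _ => ?_
  constructor
  · rintro ⟨y, hy, rfl⟩
    simpa [mul_assoc] using hy
  · intro hx
    exact ⟨_, hx, by simp [mul_assoc]⟩

theorem conjInter_mul (G T : LinearAlgebraicGroup k n) (K : Subgroup (G.points k))
    (g : G.points k) {h : G.points k} (hh : h ∈ G.centralizerPoints T) :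
    G.conjInter T K (g * h) = G.conjInter T K g := by
  ext x
  rw [mem_conjInter, mem_conjInter]
  refine and_congr_right fun hx => ?_
  have e : g * h * x * (g * h)⁻¹ = g * x * g⁻¹ := by
    rw [mul_assoc g h x, ← G.commute_of_mem T hh hx]
    group
  rw [e]

end General

section Padic

variable {p : ℕ} [Fact p.Prime] {n : ℕ}

/-- `G(ℤ_p) = G(ℚ_p) ∩ GL_n(ℤ_p)`, the group of `ℤ_p`-points of the Zariski closure of `G` in
`GL_n` over `ℤ_p`. -/
noncomputable def integralPoints (G : LinearAlgebraicGroup ℚ_[p] n) : Subgroup (G.points ℚ_[p]) :=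
  (Matrix.GeneralLinearGroup.map (n := Fin n) (algebraMap ℤ_[p] ℚ_[p])).range.subgroupOf
    (G.points ℚ_[p])

/-- The compact subgroups of `T(ℚ_p)` (inside `G(ℚ_p)`, with the `p`-adic topology). -/
def compactSubgroups (G T : LinearAlgebraicGroup ℚ_[p] n) : Set (Subgroup (G.points ℚ_[p])) :=
  {C | C ≤ G.rationalPoints T ∧ IsCompact (C : Set (G.points ℚ_[p]))}

/-- `K_T`: the subgroup of `T(ℚ_p)` generated by all compact subgroups. It is the maximal compact
subgroup of `T(ℚ_p)` as soon as there is a largest compact subgroup. -/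
noncomputable def maximalCompact (G T : LinearAlgebraicGroup ℚ_[p] n) : Subgroup (G.points ℚ_[p]) :=
  sSup (G.compactSubgroups T)

/-- The function `I(g) = |K_T / (T(ℚ_p) ∩ g⁻¹ K g)|` on `G(ℚ_p) / Z_G(T)(ℚ_p)`
(with the convention that the value is `0` if this index is infinite). -/
noncomputable def indexFunction (G T : LinearAlgebraicGroup ℚ_[p] n)
    (K : Subgroup (G.points ℚ_[p])) : G.points ℚ_[p] ⧸ G.centralizerPoints T → ℕ :=
  Quotient.lift (fun g => (G.conjInter T K g).relIndex (G.maximalCompact T)) (by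
    intro a b hab
    have h : a⁻¹ * b ∈ G.centralizerPoints T := QuotientGroup.leftRel_apply.1 hab
    have := G.conjInter_mul T K a h
    rw [mul_inv_cancel_left] at this
    simp only [this])

end Padic

end LinearAlgebraicGroup

/-! One element of `K_T` controls the index. Take `X` in the Lie algebra of `T` on which distinct
weights take distinct values, and put `t = exp(p^j X)` with `j` large. Then `t` lies in `K_T`, and
every power `t^m` with `m ≠ 0` is semisimple with centralizer in `G(ℚ_p)` contained in `H(ℚ_p)`
(`exists_regular_mem_maximalCompact`). If `I(g) ≤ N`, then `s = t^(N!)` lies in `g⁻¹Kg`, that is, `g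
s g⁻¹ ∈ K`, and `s` does not depend on `g`.

Let `Q` be a separable polynomial killing `s`. The elements of `K` killed by `Q` form a compact set
in which the `K`-conjugacy classes are open, so there are finitely many of them
(`exists_finite_conj`). Hence `g ∈ K f H` for some `f` in a finite set, and `{I ≤ N}` lies in a
compact set. This gives (1). It also gives (2), because the orbits of the open subgroup `G(ℤ_p)` are
open and finitely many of them cover a compact set.

Openness of the classes (`eventually_exists_conj_of_exp`) is a tangent space argument: `𝔤` is the
sum of the image of `1 - Ad s` and the centralizer of `s`, so an element of the group near `s` has
the form `k w s k⁻¹` with `w` near `1` commuting with `s`. If it is killed by `Q`, then so is `w s`,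
which forces `w = 1` because `s` is an isolated root of `Q` in its commutant.

For (0), diagonalise `T` over an algebraic closure: `K_T` consists of the points at which all
weights have absolute value `1`. The index is finite because `K` is open. -/

/-! ### Split tori: characters and simultaneous diagonalisation. -/

/-- The value of the character of weight `a` of `𝔾_m^r` at a point `s`. -/
def weightChar {r : ℕ} {R : Type} [CommRing R] (s : Fin r → Rˣ) (a : Fin r → ℤ) : Rˣ :=
  ∏ i, s i ^ a i

theorem weightChar_mul {r : ℕ} {R : Type} [CommRing R] (s t : Fin r → Rˣ) (a : Fin r → ℤ) :
    weightChar (s * t) a = weightChar s a * weightChar t a := by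
  simp [weightChar, mul_zpow, Finset.prod_mul_distrib]

theorem weightChar_add {r : ℕ} {R : Type} [CommRing R] (s : Fin r → Rˣ) (a b : Fin r → ℤ) :
    weightChar s (a + b) = weightChar s a * weightChar s b := by
  simp [weightChar, zpow_add, Finset.prod_mul_distrib]

theorem weightChar_zero {r : ℕ} {R : Type} [CommRing R] (s : Fin r → Rˣ) :
    weightChar s 0 = 1 := by
  simp [weightChar]

theorem weightChar_one {r : ℕ} {R : Type} [CommRing R] (a : Fin r → ℤ) :
    weightChar (1 : Fin r → Rˣ) a = 1 := by
  simp [weightChar]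

/-- The group elements, as units of the group algebra. -/
noncomputable def groupAlgebraUnit (F B : Type) [CommRing F] [AddCommGroup B] :
    Multiplicative B →* (AddMonoidAlgebra F B)ˣ :=
  (Units.map (AddMonoidAlgebra.of F B)).comp (toUnits (G := Multiplicative B)).toMonoidHom

theorem groupAlgebraUnit_coe (F B : Type) [CommRing F] [AddCommGroup B] (b : B) :
    (groupAlgebraUnit F B (Multiplicative.ofAdd b) : AddMonoidAlgebra F B) =
      AddMonoidAlgebra.single b 1 := rfl

theorem weightChar_groupAlgebraUnit (F B : Type) [CommRing F] [AddCommGroup B] {r : ℕ}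
    (f : (Fin r → ℤ) →+ B) (a : Fin r → ℤ) :
    weightChar (fun i => groupAlgebraUnit F B (Multiplicative.ofAdd (f (Pi.single i 1)))) a =
      groupAlgebraUnit F B (Multiplicative.ofAdd (f a)) := by
  unfold weightChar
  simp_rw [← map_zpow, ← map_prod, ← ofAdd_zsmul, ← ofAdd_sum, ← map_zsmul, ← map_sum]
  congr 3
  ext j
  simp [Finset.sum_apply, Pi.single_apply]

/-- The coordinate ring of `𝔾_m^r`. -/
abbrev LaurentRing (F : Type) [CommRing F] (r : ℕ) : Type := AddMonoidAlgebra F (Fin r → ℤ)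

/-- Evaluation of Laurent polynomials at a point of `𝔾_m^r`. -/
noncomputable def laurentEval (F : Type) [CommRing F] {r : ℕ} {R : Type} [CommRing R] [Algebra F R]
    (s : Fin r → Rˣ) : LaurentRing F r →ₐ[F] R :=
  AddMonoidAlgebra.lift F R (Fin r → ℤ)
    { toFun := fun a => (weightChar s a.toAdd : R)
      map_one' := by simp [weightChar_zero]
      map_mul' := fun a b => by simp [weightChar_add] }

theorem laurentEval_single (F : Type) [CommRing F] {r : ℕ} {R : Type} [CommRing R] [Algebra F R]
    (s : Fin r → Rˣ) (a : Fin r → ℤ) (c : F) :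
    laurentEval F s (AddMonoidAlgebra.single a c) = algebraMap F R c * (weightChar s a : R) := by
  simp [laurentEval, AddMonoidAlgebra.lift_single, Algebra.smul_def]

namespace LinearAlgebraicGroup

/-- A simultaneous diagonalisation of a split torus: orthogonal idempotent matrices `P a`
(the projections to the weight spaces) and coordinates `e` identifying the torus with `𝔾_m^r`. -/
structure WeightDecomposition {F : Type} [Field F] {n : ℕ} (T : LinearAlgebraicGroup F n) where
  r : ℕ
  e : ∀ (R : Type) [CommRing R] [Algebra F R], T.points R ≃* (Fin r → Rˣ)
  weights : Finset (Fin r → ℤ)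
  P : (Fin r → ℤ) → Matrix (Fin n) (Fin n) F
  P_ne_zero : ∀ a ∈ weights, P a ≠ 0
  P_mul_self : ∀ a, P a * P a = P a
  P_mul_of_ne : ∀ a b, a ≠ b → P a * P b = 0
  sum_P : ∑ a ∈ weights, P a = 1
  coe_eq : ∀ (R : Type) [CommRing R] [Algebra F R] (t : T.points R),
    ((t : GL (Fin n) R) : Matrix (Fin n) (Fin n) R) =
      ∑ a ∈ weights, (weightChar (e R t) a : R) • (P a).map (algebraMap F R)

/-- Every point of the torus is a specialisation of the universal point `u` over the Laurent ring,
by naturality of `e`. The matrices `P a` are the coefficients of `u`; their relations come from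
multiplying two independent generic points. -/
theorem IsSplitTorus.nonempty_weightDecomposition {F : Type} [Field F] {n : ℕ}
    {T : LinearAlgebraicGroup F n} (hT : T.IsSplitTorus) : Nonempty T.WeightDecomposition := by
  classical
  obtain ⟨r, e, he⟩ := hT
  let x : Fin r → (LaurentRing F r)ˣ := fun i => groupAlgebraUnit F (Fin r → ℤ)
      (Multiplicative.ofAdd (Pi.single i 1))
  let u : T.points (LaurentRing F r) := (e (LaurentRing F r)).symm x
  let P : (Fin r → ℤ) → Matrix (Fin n) (Fin n) F := fun a => Matrix.of fun i j =>
    ((u : GL (Fin n) (LaurentRing F r)) i j : LaurentRing F r).coeff a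
  let W : Finset (Fin r → ℤ) := Finset.univ.biUnion fun i => Finset.univ.biUnion fun j =>
    ((u : GL (Fin n) (LaurentRing F r)) i j : LaurentRing F r).coeff.support
  have hW : ∀ a, a ∉ W → P a = 0 := by
    intro a ha
    ext i j
    by_contra h
    apply ha
    simp only [W, Finset.mem_biUnion, Finset.mem_univ, true_and]
    exact ⟨i, j, Finsupp.mem_support_iff.2 h⟩
  have hu : ∀ (R : Type) [CommRing R] [Algebra F R] (s : Fin r → Rˣ),
      (((e R).symm s : GL (Fin n) R) : Matrix (Fin n) (Fin n) R) =
        ∑ a ∈ W, (weightChar s a : R) • (P a).map (algebraMap F R) := by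
    intro R _ _ s
    have h1 : (e R).symm s = T.pointsMap (laurentEval F s) u := by
      rw [MulEquiv.symm_apply_eq]
      funext i
      rw [he (LaurentRing F r) R (laurentEval F s) u i]
      ext
      simp only [u, MulEquiv.apply_symm_apply, Units.coe_map, MonoidHom.coe_coe, x,
        groupAlgebraUnit_coe, laurentEval_single]
      simp [weightChar, Pi.single_apply]
    rw [h1]
    ext i j
    have h2 : ((u : GL (Fin n) (LaurentRing F r)) i j : LaurentRing F r) =
        ∑ a ∈ W, AddMonoidAlgebra.single a (P a i j) := by
      ext b
      by_cases hb : b ∈ W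
      · simp [Finset.sum_apply', Finsupp.single_apply, hb, P]
      · have := congrFun (congrFun (hW b hb) i) j
        simp only [P, Matrix.of_apply, Matrix.zero_apply] at this
        simp [Finset.sum_apply', Finsupp.single_apply, hb, this]
    have h3 : ((T.pointsMap (laurentEval F s) u : GL (Fin n) R) i j : R) =
        laurentEval F s ((u : GL (Fin n) (LaurentRing F r)) i j) := rfl
    rw [h3, h2, map_sum, Matrix.sum_apply]
    refine Finset.sum_congr rfl fun a _ => ?_
    rw [laurentEval_single, Matrix.smul_apply, Matrix.map_apply, smul_eq_mul, mul_comm]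
  -- The hypothesis on `f`, `g` says that the exponents `f a + g b` separate pairs. In the product
  -- of the points `s` and `t` the coefficient at `f a + g b` is `P a * P b`; in the point `s * t`
  -- only exponents `f c + g c` occur.
  have key : ∀ (B : Type) [AddCommGroup B] (f g : (Fin r → ℤ) →+ B),
      (∀ a b c d, f a + g b = f c + g d ↔ a = c ∧ b = d) →
      ∀ a ∈ W, ∀ b ∈ W, P a * P b = if a = b then P a else 0 := by
    intro B _ f g hfg a ha b hb
    let s : Fin r → (AddMonoidAlgebra F B)ˣ := fun i =>
      groupAlgebraUnit F B (Multiplicative.ofAdd (f (Pi.single i 1)))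
    let t : Fin r → (AddMonoidAlgebra F B)ˣ := fun i =>
      groupAlgebraUnit F B (Multiplicative.ofAdd (g (Pi.single i 1)))
    have h1 := congrArg (fun z : T.points (AddMonoidAlgebra F B) =>
      ((z : GL (Fin n) (AddMonoidAlgebra F B)) : Matrix (Fin n) (Fin n) (AddMonoidAlgebra F B)))
      (map_mul (e (AddMonoidAlgebra F B)).symm s t)
    simp only [Subgroup.coe_mul, Units.val_mul] at h1
    have hs : ∀ a, (weightChar s a : AddMonoidAlgebra F B) = AddMonoidAlgebra.single (f a) 1 :=
      fun a => congrArg Units.val (weightChar_groupAlgebraUnit F B f a)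
    have ht : ∀ a, (weightChar t a : AddMonoidAlgebra F B) = AddMonoidAlgebra.single (g a) 1 :=
      fun a => congrArg Units.val (weightChar_groupAlgebraUnit F B g a)
    rw [hu, hu, hu, Finset.sum_mul_sum] at h1
    ext i j
    have h2 := congrArg (fun z : AddMonoidAlgebra F B => z.coeff (f a + g b))
      (congrFun (congrFun h1 i) j)
    have hm : ∀ x y, ((P x).map (algebraMap F (AddMonoidAlgebra F B)) *
        (P y).map (algebraMap F (AddMonoidAlgebra F B))) =
        (P x * P y).map (algebraMap F (AddMonoidAlgebra F B)) := fun x y => (Matrix.map_mul).symm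
    have hc : ∀ c d : Fin r → ℤ, f d + g c = f a + g b ↔ d = a ∧ c = b := fun c d => hfg d c a b
    simp only [Matrix.sum_apply, Matrix.smul_mul, Matrix.mul_smul, Matrix.smul_apply, hm] at h2
    simp only [weightChar_mul, Units.val_mul, hs, ht, Matrix.map_apply, smul_eq_mul,
      AddMonoidAlgebra.coe_algebraMap, AddMonoidAlgebra.single_mul_single, Function.comp_apply,
      Algebra.algebraMap_self, RingHom.id_apply, add_zero, mul_one, one_mul,
      AddMonoidAlgebra.coeff_sum, Finset.sum_apply', AddMonoidAlgebra.coeff_single,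
      Finsupp.single_apply, add_comm (g _) (f _), hc] at h2
    have h3 : (∑ x ∈ W, ∑ y ∈ W, if x = a ∧ y = b then (P x * P y) i j else 0) =
        (P a * P b) i j := by
      rw [Finset.sum_eq_single_of_mem a ha, Finset.sum_eq_single_of_mem b hb, if_pos ⟨rfl, rfl⟩]
      · exact fun y _ hy => if_neg fun h => hy h.2
      · exact fun x _ hx => Finset.sum_eq_zero fun y _ => if_neg fun h => hx h.1
    rw [h3] at h2
    simp only [ite_and, Finset.sum_ite_eq', ha, if_true] at h2
    refine h2.symm.trans ?_
    split_ifs <;> rfl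
  have horth : ∀ a b, P a * P b = if a = b then P a else 0 := by
    intro a b
    by_cases ha : a ∈ W
    swap
    · simp [hW a ha]
    by_cases hb : b ∈ W
    swap
    · rw [hW b hb, mul_zero]
      split_ifs with h
      · rw [h, hW b hb]
      · rfl
    exact key _ (AddMonoidHom.inl (Fin r → ℤ) (Fin r → ℤ))
      (AddMonoidHom.inr (Fin r → ℤ) (Fin r → ℤ)) (fun a b c d => by simp) a ha b hb
  refine ⟨⟨r, e, W.filter fun a => P a ≠ 0, P, fun a ha => (Finset.mem_filter.1 ha).2,
    fun a => by rw [horth, if_pos rfl], fun a b h => by rw [horth, if_neg h], ?_, ?_⟩⟩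
  · have h := hu F 1
    simp only [map_one, weightChar_one, Subgroup.coe_one, Units.val_one, one_smul] at h
    rw [Finset.sum_filter_ne_zero, h]
    refine Finset.sum_congr rfl fun a _ => ?_
    ext; simp
  · intro R _ _ t
    have h := hu R (e R t)
    rw [MulEquiv.symm_apply_apply] at h
    rw [h, Finset.sum_filter_of_ne]
    intro a _ h1 h2
    apply h1
    rw [h2]
    ext; simp

end LinearAlgebraicGroup

/-! ### The Lie algebra, by invariant derivations and dual numbers. -/

theorem MvPolynomial.aeval_add_mul_of_mul_self_eq_zero {k σ R : Type*} [CommRing k] [CommRing R]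
    [Algebra k R] (D : Derivation k (MvPolynomial σ k) (MvPolynomial σ k)) {e : R} (he : e * e = 0)
    (x : σ → R) (f : MvPolynomial σ k) :
    aeval (fun i => x i + e * aeval x (D (X i))) f = aeval x f + e * aeval x (D f) := by
  induction f using MvPolynomial.induction_on with
  | C a =>
    have : D (C a) = 0 := D.map_algebraMap a
    rw [this]; simp
  | add p q hp hq => simp only [map_add, hp, hq]; ring
  | mul_X p i hp =>
    simp only [map_mul, hp, aeval_X, D.leibniz, smul_eq_mul, map_add]
    linear_combination aeval x (D p) * aeval x (D (X i)) * he

/-- The invertible matrix `1 + e X`, for `e² = 0`. -/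
def Matrix.GeneralLinearGroup.oneAddSmul {n R : Type*} [Fintype n] [DecidableEq n] [CommRing R]
    (e : R) (he : e * e = 0) (X : Matrix n n R) : GL n R where
  val := 1 + e • X
  inv := 1 - e • X
  val_inv := by
    rw [add_mul, one_mul, mul_sub, mul_one, smul_mul_smul_comm, he, zero_smul]; abel
  inv_val := by
    rw [sub_mul, one_mul, mul_add, mul_one, smul_mul_smul_comm, he, zero_smul]; abel

namespace LinearAlgebraicGroup

section LieAlgebra

variable {k : Type} [Field k] {n : ℕ}

/-- The left invariant derivation on polynomials in the matrix entries attached to `X`. -/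
noncomputable def invDerivation (X : Matrix (Fin n) (Fin n) k) :
    Derivation k (MvPolynomial (Fin n × Fin n) k) (MvPolynomial (Fin n × Fin n) k) :=
  MvPolynomial.mkDerivation k fun ij => ∑ l, X l ij.2 • MvPolynomial.X (ij.1, l)

theorem invDerivation_X (X : Matrix (Fin n) (Fin n) k) (ij : Fin n × Fin n) :
    invDerivation X (MvPolynomial.X ij) = ∑ l, X l ij.2 • MvPolynomial.X (ij.1, l) :=
  MvPolynomial.mkDerivation_X _ _ _

theorem invDerivation_add (X Y : Matrix (Fin n) (Fin n) k) :
    invDerivation (X + Y) = invDerivation X + invDerivation Y := by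
  refine MvPolynomial.derivation_ext fun ij => ?_
  simp [invDerivation_X, add_smul, Finset.sum_add_distrib]

theorem invDerivation_smul (c : k) (X : Matrix (Fin n) (Fin n) k) :
    invDerivation (c • X) = c • invDerivation X := by
  refine MvPolynomial.derivation_ext fun ij => ?_
  simp [invDerivation_X, mul_smul, Finset.smul_sum]

/-- The derivative at the identity of a polynomial in the direction `X`, as a function of `X`. -/
noncomputable def derivAtOne (f : MvPolynomial (Fin n × Fin n) k) :
    Matrix (Fin n) (Fin n) k →ₗ[k] k where
  toFun X := MvPolynomial.eval (fun ij => (1 : Matrix (Fin n) (Fin n) k) ij.1 ij.2)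
    (invDerivation X f)
  map_add' X Y := by simp [invDerivation_add]
  map_smul' c X := by simp [invDerivation_smul]

/-- The Lie algebra of `G`. -/
noncomputable def lieAlgebra (G : LinearAlgebraicGroup k n) :
    Submodule k (Matrix (Fin n) (Fin n) k) :=
  ⨅ f ∈ G.eqs, LinearMap.ker (derivAtOne f)

theorem mem_lieAlgebra {G : LinearAlgebraicGroup k n} {X : Matrix (Fin n) (Fin n) k} :
    X ∈ G.lieAlgebra ↔ ∀ f ∈ G.eqs, derivAtOne f X = 0 := by
  simp [lieAlgebra]

theorem aeval_mul_oneAddSmul {R : Type} [CommRing R] [Algebra k R] (g : GL (Fin n) R) {e : R}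
    (he : e * e = 0) (X : Matrix (Fin n) (Fin n) k) (f : MvPolynomial (Fin n × Fin n) k) :
    MvPolynomial.aeval (fun ij : Fin n × Fin n =>
        (g * Matrix.GeneralLinearGroup.oneAddSmul e he (X.map (algebraMap k R))) ij.1 ij.2) f =
      MvPolynomial.aeval (fun ij : Fin n × Fin n => g ij.1 ij.2) f +
        e * MvPolynomial.aeval (fun ij : Fin n × Fin n => g ij.1 ij.2) (invDerivation X f) := by
  rw [← MvPolynomial.aeval_add_mul_of_mul_self_eq_zero _ he]
  congr 2
  funext ij
  rw [invDerivation_X, map_sum]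
  have h1 : ((g * Matrix.GeneralLinearGroup.oneAddSmul e he (X.map (algebraMap k R)) :
      GL (Fin n) R) : Matrix (Fin n) (Fin n) R) = g + e • (g * X.map (algebraMap k R)) := by
    simp only [Units.val_mul, Matrix.GeneralLinearGroup.oneAddSmul, mul_add, mul_one,
      Matrix.mul_smul]
  rw [h1, Matrix.add_apply, Matrix.smul_apply, Matrix.mul_apply, smul_eq_mul]
  congr 2
  refine Finset.sum_congr rfl fun l _ => ?_
  rw [map_smul, MvPolynomial.aeval_X, Matrix.map_apply, Algebra.smul_def, mul_comm]

theorem aeval_one_invDerivation (X : Matrix (Fin n) (Fin n) k) (R : Type) [CommRing R]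
    [Algebra k R] (f : MvPolynomial (Fin n × Fin n) k) :
    MvPolynomial.aeval (fun ij : Fin n × Fin n => (1 : GL (Fin n) R) ij.1 ij.2)
      (invDerivation X f) = algebraMap k R (derivAtOne f X) := by
  simp only [derivAtOne, LinearMap.coe_mk, AddHom.coe_mk]
  rw [← MvPolynomial.coe_aeval_eq_eval, ← Algebra.ofId_apply]
  change _ = ((Algebra.ofId k R).comp (MvPolynomial.aeval _)) _
  rw [MvPolynomial.comp_aeval]
  congr 2
  funext ij
  simp [Matrix.one_apply]

theorem oneAddSmul_mem_points {G : LinearAlgebraicGroup k n} {X : Matrix (Fin n) (Fin n) k}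
    (hX : X ∈ G.lieAlgebra) (R : Type) [CommRing R] [Algebra k R] (e : R) (he : e * e = 0) :
    Matrix.GeneralLinearGroup.oneAddSmul e he (X.map (algebraMap k R)) ∈ G.points R := by
  intro f hf
  have h2 := aeval_mul_oneAddSmul (1 : GL (Fin n) R) he X f
  rw [one_mul] at h2
  rw [h2, G.one_mem R f hf, aeval_one_invDerivation, mem_lieAlgebra.1 hX f hf, map_zero, mul_zero,
    add_zero]

theorem mem_lieAlgebra_of_dualNumber {G : LinearAlgebraicGroup k n}
    {X : Matrix (Fin n) (Fin n) k} (h : Matrix.GeneralLinearGroup.oneAddSmul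
      (DualNumber.eps : DualNumber k) DualNumber.eps_mul_eps
      (X.map (algebraMap k (DualNumber k))) ∈ G.points (DualNumber k)) : X ∈ G.lieAlgebra := by
  rw [mem_lieAlgebra]
  intro f hf
  have h2 := aeval_mul_oneAddSmul (1 : GL (Fin n) (DualNumber k)) DualNumber.eps_mul_eps X f
  rw [one_mul, h f hf, G.one_mem _ f hf, aeval_one_invDerivation, zero_add] at h2
  have h3 := congrArg TrivSqZeroExt.snd h2
  simpa [TrivSqZeroExt.algebraMap_eq_inl] using h3.symm

/-- Right translation by `1 + εX` preserves the points over `R[ε]`, and the `ε`-part of `f` at the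
translated point is its invariant derivative. So the functions vanishing on `G` are stable under the
derivation, which can then be iterated. -/
theorem invDerivation_vanishes {G : LinearAlgebraicGroup k n} {X : Matrix (Fin n) (Fin n) k}
    (hX : X ∈ G.lieAlgebra) {f : MvPolynomial (Fin n × Fin n) k}
    (hf : ∀ (R : Type) [CommRing R] [Algebra k R], ∀ g ∈ G.points R,
      MvPolynomial.aeval (fun ij : Fin n × Fin n => g ij.1 ij.2) f = 0)
    (R : Type) [CommRing R] [Algebra k R] (g : GL (Fin n) R) (hg : g ∈ G.points R) :
    MvPolynomial.aeval (fun ij : Fin n × Fin n => g ij.1 ij.2) (invDerivation X f) = 0 := by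
  have he : (DualNumber.eps : DualNumber R) * DualNumber.eps = 0 := DualNumber.eps_mul_eps
  let i : R →ₐ[k] DualNumber R := TrivSqZeroExt.inlAlgHom k R R
  have hg' := G.map_mem_points i hg
  have h2 := aeval_mul_oneAddSmul (Matrix.GeneralLinearGroup.map (i : R →+* DualNumber R) g) he X f
  rw [hf _ _ (MulMemClass.mul_mem hg' (oneAddSmul_mem_points hX _ _ he)), hf _ _ hg', zero_add] at h2
  have h3 : MvPolynomial.aeval (fun ij : Fin n × Fin n =>
      Matrix.GeneralLinearGroup.map (i : R →+* DualNumber R) g ij.1 ij.2) (invDerivation X f) =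
      i (MvPolynomial.aeval (fun ij : Fin n × Fin n => g ij.1 ij.2) (invDerivation X f)) := by
    rw [← AlgHom.comp_apply, MvPolynomial.comp_aeval]
    rfl
  rw [h3] at h2
  have h4 := congrArg TrivSqZeroExt.snd h2
  simpa [i] using h4.symm

theorem eval_one_iterate_invDerivation {G : LinearAlgebraicGroup k n}
    {X : Matrix (Fin n) (Fin n) k} (hX : X ∈ G.lieAlgebra) {f : MvPolynomial (Fin n × Fin n) k}
    (hf : f ∈ G.eqs) (m : ℕ) :
    MvPolynomial.eval (fun ij => (1 : Matrix (Fin n) (Fin n) k) ij.1 ij.2)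
      ((invDerivation X)^[m] f) = 0 := by
  have h : ∀ (R : Type) [CommRing R] [Algebra k R], ∀ g ∈ G.points R,
      MvPolynomial.aeval (fun ij : Fin n × Fin n => g ij.1 ij.2) ((invDerivation X)^[m] f) = 0 := by
    induction m with
    | zero => exact fun R _ _ g hg => hg f hf
    | succ m ih =>
      intro R _ _ g hg
      rw [Function.iterate_succ_apply']
      exact invDerivation_vanishes hX ih R g hg
  simpa [MvPolynomial.aeval_eq_eval] using h k 1 (OneMemClass.one_mem _)

theorem conj_mem_lieAlgebra {G : LinearAlgebraicGroup k n} {X : Matrix (Fin n) (Fin n) k}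
    (hX : X ∈ G.lieAlgebra) {s : GL (Fin n) k} (hs : s ∈ G.points k) :
    (s : Matrix (Fin n) (Fin n) k) * X * ((s⁻¹ : GL (Fin n) k) : Matrix (Fin n) (Fin n) k) ∈
      G.lieAlgebra := by
  suffices key : ∀ (R : Type) [CommRing R] [Algebra k R] (e : R) (he : e * e = 0),
      Matrix.GeneralLinearGroup.oneAddSmul e he (((s : Matrix (Fin n) (Fin n) k) * X *
        ((s⁻¹ : GL (Fin n) k) : Matrix (Fin n) (Fin n) k)).map (algebraMap k R)) ∈ G.points R from
    mem_lieAlgebra_of_dualNumber (key _ _ _)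
  intro R _ _ e he
  have hs' := G.map_mem_points (Algebra.ofId k R) hs
  convert MulMemClass.mul_mem (MulMemClass.mul_mem hs' (oneAddSmul_mem_points hX R e he))
    (InvMemClass.inv_mem hs') using 1
  rw [eq_mul_inv_iff_mul_eq]
  ext1
  have h1 : ((s⁻¹ : GL (Fin n) k) : Matrix (Fin n) (Fin n) k).map (algebraMap k R) *
      (s : Matrix (Fin n) (Fin n) k).map (algebraMap k R) = 1 := by
    rw [← Matrix.map_mul, Units.inv_mul]; simp
  simp only [Units.val_mul, Matrix.GeneralLinearGroup.oneAddSmul]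
  change (1 + e • (_ * _ * _ : Matrix _ _ _).map (algebraMap k R)) * (s.val.map (algebraMap k R)) =
    (s.val.map (algebraMap k R)) * _
  rw [Matrix.map_mul, Matrix.map_mul, add_mul, mul_add, one_mul, mul_one, Matrix.smul_mul,
    Matrix.mul_assoc, h1, mul_one, Matrix.mul_smul]

end LieAlgebra

end LinearAlgebraicGroup

/-! ### The p-adic exponential in a Banach algebra. -/

section PadicExp

open NormedSpace Filter Topology

variable {p : ℕ} [Fact p.Prime]

/-- Legendre's formula bounds the valuation of `m!` by `m`. The exponential series therefore has
radius of convergence at least `1/p`. -/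
theorem Padic.one_le_norm_factorial_mul_pow (m : ℕ) :
    1 ≤ ‖(m.factorial : ℚ_[p])‖ * (p : ℝ) ^ m := by
  have hp : 1 < (p : ℝ) := by exact_mod_cast (Fact.out : p.Prime).one_lt
  have h0 : (m.factorial : ℚ_[p]) ≠ 0 := by exact_mod_cast m.factorial_ne_zero
  rw [Padic.norm_eq_zpow_neg_valuation h0, Padic.valuation_natCast, ← zpow_natCast (p : ℝ) m,
    ← zpow_add₀ (by positivity)]
  apply one_le_zpow₀ hp.le
  have h1 := sub_one_mul_padicValNat_factorial (p := p) m
  have h2 : 1 ≤ p - 1 := Nat.le_sub_one_of_lt (Fact.out : p.Prime).one_lt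
  have h3 : padicValNat p m.factorial ≤ m := by
    calc _ ≤ (p - 1) * padicValNat p m.factorial := Nat.le_mul_of_pos_left _ h2
      _ ≤ m := by rw [h1]; exact Nat.sub_le _ _
  omega

theorem Padic.tendsto_pow_nhdsNE_zero :
    Tendsto (fun j : ℕ => (p : ℚ_[p]) ^ j) atTop (𝓝[≠] 0) := by
  refine tendsto_nhdsWithin_iff.2 ⟨tendsto_pow_atTop_nhds_zero_of_norm_lt_one Padic.norm_p_lt_one,
    Eventually.of_forall fun j => ?_⟩
  have : (p : ℚ_[p]) ≠ 0 := by exact_mod_cast (Fact.out : p.Prime).ne_zero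
  exact pow_ne_zero _ this

/-- A derivative at `0` can be computed along `p^j → 0`. Since `exp(p^j x)` is a power of `exp x`, a
property of `exp x` inherited by its powers passes in this way to `x`. -/
theorem HasDerivAt.eq_zero_of_padic_pow {F : Type*} [NormedAddCommGroup F] [NormedSpace ℚ_[p] F]
    {φ : ℚ_[p] → F} {φ' : F} (h : HasDerivAt φ φ' 0) (h0 : φ 0 = 0)
    (hφ : ∀ᶠ j : ℕ in atTop, φ ((p : ℚ_[p]) ^ j) = 0) : φ' = 0 := by
  have h1 := (hasDerivAt_iff_tendsto_slope.1 h).comp Padic.tendsto_pow_nhdsNE_zero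
  refine tendsto_nhds_unique h1 (tendsto_const_nhds.congr' ?_)
  filter_upwards [hφ] with j hj
  simp [slope, h0, hj]

variable {𝔸 : Type*} [NormedRing 𝔸] [NormedAlgebra ℚ_[p] 𝔸]

theorem Padic.expSeries_radius_pos : 0 < (expSeries ℚ_[p] 𝔸).radius := by
  have hp : 0 < (p : ℝ) := by exact_mod_cast (Fact.out : p.Prime).pos
  have h : (((p : NNReal)⁻¹ : NNReal) : ENNReal) ≤ (expSeries ℚ_[p] 𝔸).radius := by
    refine FormalMultilinearSeries.le_radius_of_bound _ (max 1 ‖(1 : 𝔸)‖) fun m => ?_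
    have h1 : ‖expSeries ℚ_[p] 𝔸 m‖ ≤ ‖(m.factorial : ℚ_[p])‖⁻¹ * max 1 ‖(1 : 𝔸)‖ := by
      rw [expSeries_eq_ofScalars, FormalMultilinearSeries.ofScalars_norm_eq_mul, norm_inv]
      refine mul_le_mul_of_nonneg_left ?_ (by positivity)
      cases m with
      | zero => exact ContinuousMultilinearMap.norm_mkPiAlgebraFin_zero.le.trans (le_max_right _ _)
      | succ m => exact ContinuousMultilinearMap.norm_mkPiAlgebraFin_succ_le.trans (le_max_left _ _)
    have h2 := Padic.one_le_norm_factorial_mul_pow (p := p) m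
    have h0 : 0 < ‖(m.factorial : ℚ_[p])‖ := by
      rw [norm_pos_iff]; exact_mod_cast m.factorial_ne_zero
    have h3 : ‖(m.factorial : ℚ_[p])‖⁻¹ ≤ (p : ℝ) ^ m := by
      rw [inv_le_iff_one_le_mul₀ h0]; linarith
    have h4 : (0 : ℝ) < max 1 ‖(1 : 𝔸)‖ := lt_max_of_lt_left one_pos
    calc _ ≤ ((p : ℝ) ^ m * max 1 ‖(1 : 𝔸)‖) * ((p : ℝ)⁻¹) ^ m := by
            push_cast
            gcongr
            exact h1.trans (by gcongr)
      _ = max 1 ‖(1 : 𝔸)‖ := by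
            rw [mul_right_comm, ← mul_pow, mul_inv_cancel₀ hp.ne', one_pow, one_mul]
  refine lt_of_lt_of_le ?_ h
  have : 0 < (p : NNReal)⁻¹ := by
    rw [inv_pos]; exact_mod_cast (Fact.out : p.Prime).pos
  exact_mod_cast this

variable (𝔸) in
/-- The open ball on which the `p`-adic exponential series converges. -/
def padicExpBall (p : ℕ) [Fact p.Prime] [NormedAlgebra ℚ_[p] 𝔸] : Set 𝔸 :=
  Metric.eball (0 : 𝔸) (expSeries ℚ_[p] 𝔸).radius

theorem padicExpBall_mem_nhds : padicExpBall 𝔸 p ∈ 𝓝 (0 : 𝔸) :=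
  Metric.eball_mem_nhds _ Padic.expSeries_radius_pos

theorem smul_mem_padicExpBall {c : ℚ_[p]} (hc : ‖c‖ ≤ 1) {x : 𝔸} (hx : x ∈ padicExpBall 𝔸 p) :
    c • x ∈ padicExpBall 𝔸 p := by
  simp only [padicExpBall, Metric.mem_eball, edist_zero_right] at hx ⊢
  refine lt_of_le_of_lt ?_ hx
  rw [enorm_le_iff_norm_le, norm_smul]
  exact mul_le_of_le_one_left (norm_nonneg _) hc

theorem neg_mem_padicExpBall {x : 𝔸} (hx : x ∈ padicExpBall 𝔸 p) : -x ∈ padicExpBall 𝔸 p := by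
  simpa [padicExpBall, Metric.mem_eball, edist_zero_right] using hx

variable [CompleteSpace 𝔸]

theorem padicExp_mul_neg {x : 𝔸} (hx : x ∈ padicExpBall 𝔸 p) : exp x * exp (-x) = 1 := by
  rw [← exp_add_of_commute_of_mem_ball (𝕂 := ℚ_[p]) (Commute.neg_right (Commute.refl x)) hx
    (neg_mem_padicExpBall hx), add_neg_cancel, exp_zero]

theorem padicExp_neg_mul {x : 𝔸} (hx : x ∈ padicExpBall 𝔸 p) : exp (-x) * exp x = 1 := by
  simpa using padicExp_mul_neg (p := p) (neg_mem_padicExpBall hx)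

/-- The exponential of an element of the ball of convergence, as a unit. -/
noncomputable def padicExpUnit (x : 𝔸) (hx : x ∈ padicExpBall 𝔸 p) : 𝔸ˣ where
  val := exp x
  inv := exp (-x)
  val_inv := padicExp_mul_neg hx
  inv_val := padicExp_neg_mul hx

theorem padicExp_natCast_smul {x : 𝔸} (hx : x ∈ padicExpBall 𝔸 p) (m : ℕ) :
    exp ((m : ℚ_[p]) • x) = exp x ^ m := by
  induction m with
  | zero => simp
  | succ m ih =>
    have hm : ‖(m : ℚ_[p])‖ ≤ 1 := by exact_mod_cast Padic.norm_int_le_one (p := p) m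
    rw [Nat.cast_succ, add_smul, one_smul, pow_succ, ← ih]
    exact exp_add_of_commute_of_mem_ball (𝕂 := ℚ_[p]) ((Commute.refl x).smul_left _)
      (smul_mem_padicExpBall hm hx) hx

theorem hasStrictFDerivAt_padicExp :
    HasStrictFDerivAt (exp : 𝔸 → 𝔸)
      ((ContinuousLinearEquiv.refl ℚ_[p] 𝔸 : 𝔸 ≃L[ℚ_[p]] 𝔸) : 𝔸 →L[ℚ_[p]] 𝔸) 0 :=
  hasStrictFDerivAt_exp_zero_of_radius_pos Padic.expSeries_radius_pos

theorem hasDerivAt_padicExp_smul (x : 𝔸) :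
    HasDerivAt (fun c : ℚ_[p] => exp (c • x)) x 0 := by
  have h1 : HasDerivAt (fun c : ℚ_[p] => c • x) x 0 := by
    simpa using (hasDerivAt_id (0 : ℚ_[p])).smul_const x
  have h2 : HasFDerivAt (exp : 𝔸 → 𝔸)
      ((ContinuousLinearEquiv.refl ℚ_[p] 𝔸 : 𝔸 ≃L[ℚ_[p]] 𝔸) : 𝔸 →L[ℚ_[p]] 𝔸)
      ((0 : ℚ_[p]) • x) := by
    rw [zero_smul]; exact hasStrictFDerivAt_padicExp.hasFDerivAt
  exact h2.comp_hasDerivAt (0 : ℚ_[p]) h1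

theorem tendsto_padicExp_zero (p : ℕ) [Fact p.Prime] (𝔸 : Type*) [NormedRing 𝔸]
    [NormedAlgebra ℚ_[p] 𝔸] [CompleteSpace 𝔸] : Tendsto (exp : 𝔸 → 𝔸) (𝓝 0) (𝓝 1) := by
  have h := (hasStrictFDerivAt_padicExp (p := p) (𝔸 := 𝔸)).hasFDerivAt.continuousAt
  simpa [ContinuousAt] using h

/-- A logarithm: a local inverse of the exponential. -/
theorem exists_padicLog (p : ℕ) [Fact p.Prime] (𝔸 : Type*) [NormedRing 𝔸] [NormedAlgebra ℚ_[p] 𝔸]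
    [CompleteSpace 𝔸] : ∃ log : 𝔸 → 𝔸,
      HasStrictFDerivAt log (ContinuousLinearMap.id ℚ_[p] 𝔸) 1 ∧ log 1 = 0 ∧
      ∀ᶠ x in 𝓝 (1 : 𝔸), exp (log x) = x := by
  have h := hasStrictFDerivAt_padicExp (p := p) (𝔸 := 𝔸)
  refine ⟨h.localInverse exp _ 0, ?_, ?_, ?_⟩
  · simpa using h.to_localInverse
  · simpa using h.localInverse_apply_image
  · simpa using h.eventually_right_inverse

/-- If `g` commutes with small multiples of `exp x`, then `g` commutes with `x`. -/
theorem commute_of_commute_padicExp {g x : 𝔸} (hx : x ∈ padicExpBall 𝔸 p)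
    (h : Commute g (exp x)) : Commute g x := by
  have h1 := (hasDerivAt_padicExp_smul (p := p) x)
  have h2 : HasDerivAt (fun c : ℚ_[p] => g * exp (c • x) - exp (c • x) * g) (g * x - x * g) 0 :=
    (h1.const_mul g).sub (h1.mul_const g)
  refine sub_eq_zero.1 (h2.eq_zero_of_padic_pow (by simp) (Eventually.of_forall fun j => ?_))
  rw [← Nat.cast_pow, padicExp_natCast_smul hx, sub_eq_zero]
  exact (h.pow_right _).eq

end PadicExp

/-! ### Taylor expansion along one-parameter subgroups; exponentials and points of `G`. -/

theorem Derivation.iterate_apply_mul {R A : Type*} [CommRing R] [CommRing A] [Algebra R A]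
    (D : Derivation R A A) (n : ℕ) (a b : A) :
    D^[n] (a * b) = ∑ ij ∈ Finset.HasAntidiagonal.antidiagonal n,
      n.choose ij.1 • (D^[ij.1] a * D^[ij.2] b) := by
  induction n with
  | zero => simp
  | succ n ih =>
    rw [Finset.sum_antidiagonal_choose_succ_nsmul (M := A) (fun i j => D^[i] a * D^[j] b) n]
    simp only [Function.iterate_succ_apply', ih, map_sum, map_nsmul, D.leibniz, smul_eq_mul,
      smul_add, Finset.sum_add_distrib, add_right_inj]
    refine Finset.sum_congr rfl fun ⟨i, j⟩ hij ↦ ?_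
    rw [n.choose_symm_of_eq_add (Finset.HasAntidiagonal.mem_antidiagonal.1 hij).symm, mul_comm]

section MatrixExp

open NormedSpace Filter Topology
open scoped Matrix.Norms.Operator

variable {p : ℕ} [Fact p.Prime] {n : ℕ}

instance Padic.matrix_properSpace : ProperSpace (Matrix (Fin n) (Fin n) ℚ_[p]) :=
  FiniteDimensional.proper ℚ_[p] _

theorem Padic.isOpenEmbedding_generalLinearGroup_val :
    Topology.IsOpenEmbedding (Units.val : GL (Fin n) ℚ_[p] → Matrix (Fin n) (Fin n) ℚ_[p]) :=
  Units.isOpenEmbedding_val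

/-- The entry of a matrix, as a continuous linear functional. -/
noncomputable def Padic.matrixEntry (ij : Fin n × Fin n) :
    Matrix (Fin n) (Fin n) ℚ_[p] →L[ℚ_[p]] ℚ_[p] :=
  LinearMap.toContinuousLinearMap (Matrix.entryLinearMap ℚ_[p] ℚ_[p] ij.1 ij.2)

theorem Padic.matrixEntry_apply (ij : Fin n × Fin n) (X : Matrix (Fin n) (Fin n) ℚ_[p]) :
    Padic.matrixEntry ij X = X ij.1 ij.2 := rfl

namespace LinearAlgebraicGroup

theorem iterate_invDerivation_X {k : Type} [Field k] (X : Matrix (Fin n) (Fin n) k)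
    (ij : Fin n × Fin n) (m : ℕ) :
    (invDerivation X)^[m] (MvPolynomial.X ij) =
      ∑ l, (X ^ m) l ij.2 • MvPolynomial.X (ij.1, l) := by
  induction m with
  | zero => simp [Matrix.one_apply, ite_smul]
  | succ m ih =>
    rw [Function.iterate_succ_apply', ih]
    simp only [map_sum, Derivation.map_smul, invDerivation_X, Finset.smul_sum, smul_smul]
    rw [Finset.sum_comm]
    refine Finset.sum_congr rfl fun l _ => ?_
    rw [← Finset.sum_smul, pow_succ', Matrix.mul_apply]
    congr 1
    exact Finset.sum_congr rfl fun _ _ => mul_comm _ _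

/-- The Taylor coefficients at `c = 0` of a polynomial function of `exp (c X)`. -/
noncomputable def taylorCoeff {k : Type} [Field k] (X : Matrix (Fin n) (Fin n) k)
    (f : MvPolynomial (Fin n × Fin n) k) (m : ℕ) : k :=
  (m.factorial : k)⁻¹ *
    MvPolynomial.eval (fun ij => (1 : Matrix (Fin n) (Fin n) k) ij.1 ij.2) ((invDerivation X)^[m] f)

theorem taylorCoeff_add {k : Type} [Field k] (X : Matrix (Fin n) (Fin n) k)
    (f g : MvPolynomial (Fin n × Fin n) k) (m : ℕ) :
    taylorCoeff X (f + g) m = taylorCoeff X f m + taylorCoeff X g m := by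
  simp only [taylorCoeff, iterate_map_add, map_add, mul_add]

theorem taylorCoeff_mul {k : Type} [Field k] [CharZero k] (X : Matrix (Fin n) (Fin n) k)
    (f g : MvPolynomial (Fin n × Fin n) k) (m : ℕ) :
    taylorCoeff X (f * g) m = ∑ kl ∈ Finset.HasAntidiagonal.antidiagonal m,
      taylorCoeff X f kl.1 * taylorCoeff X g kl.2 := by
  unfold taylorCoeff
  rw [Derivation.iterate_apply_mul, map_sum, Finset.mul_sum]
  refine Finset.sum_congr rfl fun kl hkl => ?_
  rw [map_nsmul, map_mul, nsmul_eq_mul, ← Finset.HasAntidiagonal.mem_antidiagonal.mp hkl,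
    Nat.cast_add_choose]
  have h2 : ((kl.1 + kl.2).factorial : k) ≠ 0 := by
    exact_mod_cast Nat.factorial_ne_zero _
  field_simp

theorem taylorCoeff_C {k : Type} [Field k] (X : Matrix (Fin n) (Fin n) k) (a : k) (m : ℕ) :
    taylorCoeff X (MvPolynomial.C a) m = if m = 0 then a else 0 := by
  cases m with
  | zero => simp [taylorCoeff]
  | succ m =>
    have h1 : invDerivation X (MvPolynomial.C a) = 0 := (invDerivation X).map_algebraMap a
    have h2 : ∀ m : ℕ, (invDerivation X)^[m] 0 = 0 := fun m => by
      induction m with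
      | zero => rfl
      | succ m ih => rw [Function.iterate_succ_apply, map_zero, ih]
    rw [taylorCoeff, Function.iterate_succ_apply, h1, h2, map_zero, mul_zero]
    simp

theorem taylorCoeff_X {k : Type} [Field k] (X : Matrix (Fin n) (Fin n) k) (ij : Fin n × Fin n)
    (m : ℕ) : taylorCoeff X (MvPolynomial.X ij) m =
      Matrix.entryLinearMap k k ij.1 ij.2 ((m.factorial : k)⁻¹ • X ^ m) := by
  rw [taylorCoeff, iterate_invDerivation_X]
  simp [MvPolynomial.smul_eval, Matrix.one_apply]

/-- Taylor expansion of a polynomial function of `exp X`. -/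
theorem summable_and_tsum_taylorCoeff {X : Matrix (Fin n) (Fin n) ℚ_[p]}
    (hX : X ∈ padicExpBall (Matrix (Fin n) (Fin n) ℚ_[p]) p)
    (f : MvPolynomial (Fin n × Fin n) ℚ_[p]) :
    (Summable fun m : ℕ => ‖taylorCoeff X f m‖) ∧
    ∑' m : ℕ, taylorCoeff X f m = MvPolynomial.eval (fun ij => (exp X) ij.1 ij.2) f := by
  have hXs : ∀ ij, (Summable fun m : ℕ => ‖taylorCoeff X (MvPolynomial.X ij) m‖) ∧
      ∑' m : ℕ, taylorCoeff X (MvPolynomial.X ij) m = (exp X) ij.1 ij.2 := by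
    intro ij
    have h1 : ∀ m : ℕ, taylorCoeff X (MvPolynomial.X ij) m =
        Padic.matrixEntry ij ((m.factorial : ℚ_[p])⁻¹ • X ^ m) := taylorCoeff_X X ij
    simp_rw [h1]
    constructor
    · refine Summable.of_nonneg_of_le (fun _ => norm_nonneg _)
        (fun m => (Padic.matrixEntry ij).le_opNorm _)
        ((norm_expSeries_summable_of_mem_ball' (𝕂 := ℚ_[p]) X hX).mul_left _)
    · exact ((Padic.matrixEntry ij).hasSum
        (expSeries_hasSum_exp_of_mem_ball' (𝕂 := ℚ_[p]) X hX)).tsum_eq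
  induction f using MvPolynomial.induction_on with
  | C a =>
    constructor
    · refine summable_of_ne_finset_zero (s := {0}) fun m hm => ?_
      rw [taylorCoeff_C, if_neg (by simpa using hm), norm_zero]
    · simp_rw [taylorCoeff_C, tsum_ite_eq, MvPolynomial.eval_C]
  | add f g hf hg =>
    simp_rw [taylorCoeff_add]
    exact ⟨.of_nonneg_of_le (fun _ => norm_nonneg _) (fun _ => norm_add_le _ _) (hf.1.add hg.1),
      by rw [hf.1.of_norm.tsum_add hg.1.of_norm, hf.2, hg.2, map_add]⟩
  | mul_X f ij hf =>
    have hg := hXs ij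
    simp_rw [taylorCoeff_mul]
    constructor
    · exact summable_norm_sum_mul_antidiagonal_of_summable_norm hf.1 hg.1
    · rw [← tsum_mul_tsum_eq_tsum_sum_antidiagonal_of_summable_norm hf.1 hg.1, hf.2, hg.2,
        map_mul, MvPolynomial.eval_X]

/-- Every Taylor coefficient of a defining equation `f` along `X` vanishes, as the iterated
derivatives of `f` vanish at `1`; hence `f(exp X) = 0`. -/
theorem padicExpUnit_mem_points {G : LinearAlgebraicGroup ℚ_[p] n}
    {X : Matrix (Fin n) (Fin n) ℚ_[p]}
    (hX : X ∈ padicExpBall (Matrix (Fin n) (Fin n) ℚ_[p]) p) (hXG : X ∈ G.lieAlgebra) :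
    padicExpUnit X hX ∈ G.points ℚ_[p] := by
  intro f hf
  have h := (summable_and_tsum_taylorCoeff hX f).2
  simp only [taylorCoeff, eval_one_iterate_invDerivation hXG hf, mul_zero, tsum_zero] at h
  rw [MvPolynomial.aeval_eq_eval]
  exact h.symm

theorem hasDerivAt_eval_padicExp (X : Matrix (Fin n) (Fin n) ℚ_[p])
    (f : MvPolynomial (Fin n × Fin n) ℚ_[p]) :
    HasDerivAt (fun c : ℚ_[p] => MvPolynomial.eval (fun ij => (exp (c • X)) ij.1 ij.2) f)
      (derivAtOne f X) 0 := by
  induction f using MvPolynomial.induction_on with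
  | C a =>
    have h1 : derivAtOne (MvPolynomial.C a) X = 0 := by
      simp [derivAtOne]
    simp only [MvPolynomial.eval_C, h1]
    exact hasDerivAt_const _ _
  | add f g hf hg =>
    have h1 : derivAtOne (f + g) X = derivAtOne f X + derivAtOne g X := by
      simp [derivAtOne]
    simp only [map_add, h1]
    exact hf.add hg
  | mul_X f ij hf =>
    have h1 : derivAtOne (f * MvPolynomial.X ij) X =
        derivAtOne f X * (exp ((0 : ℚ_[p]) • X)) ij.1 ij.2 +
        MvPolynomial.eval (fun ij => (exp ((0 : ℚ_[p]) • X)) ij.1 ij.2) f * X ij.1 ij.2 := by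
      simp [derivAtOne, Derivation.leibniz, invDerivation_X, MvPolynomial.smul_eval,
        Matrix.one_apply]
      ring
    have h2 : HasDerivAt (fun c : ℚ_[p] => (exp (c • X)) ij.1 ij.2) (X ij.1 ij.2) 0 :=
      (Padic.matrixEntry ij).hasFDerivAt.comp_hasDerivAt (0 : ℚ_[p]) (hasDerivAt_padicExp_smul X)
    simp only [map_mul, MvPolynomial.eval_X, h1]
    exact hf.mul h2

/-- A defining equation vanishes at all powers of `exp X`, in particular at `exp(p^j X)`, so its
derivative at `1` along `X` is zero. -/
theorem mem_lieAlgebra_of_exp_mem {G : LinearAlgebraicGroup ℚ_[p] n}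
    {X : Matrix (Fin n) (Fin n) ℚ_[p]} (hX : X ∈ padicExpBall (Matrix (Fin n) (Fin n) ℚ_[p]) p)
    (hXG : padicExpUnit X hX ∈ G.points ℚ_[p]) : X ∈ G.lieAlgebra := by
  rw [mem_lieAlgebra]
  intro f hf
  refine (hasDerivAt_eval_padicExp X f).eq_zero_of_padic_pow ?_ (Eventually.of_forall fun j => ?_)
  · simpa [MvPolynomial.aeval_eq_eval, Matrix.one_apply] using G.one_mem ℚ_[p] f hf
  · have h := pow_mem hXG (p ^ j) f hf
    have h1 : exp (((p ^ j : ℕ) : ℚ_[p]) • X) = exp X ^ (p ^ j) := padicExp_natCast_smul hX _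
    rw [← Nat.cast_pow, h1]
    rw [MvPolynomial.aeval_eq_eval] at h
    exact h

end LinearAlgebraicGroup

end MatrixExp

/-! ### Roots of separable polynomials in noncommutative algebras. -/

section Rigidity

open Polynomial

/-- The commutator with `y` is a derivation, and it acts on polynomials in `s` by the chain rule
once `c` commutes with `s`. When `P` is separable and `P(s) = 0`, this forces `c = 0`. -/
theorem Polynomial.aeval_mul_sub_mul_aeval_of_commute {k A : Type*} [CommRing k] [Ring A]
    [Algebra k A] {s y c : A} (h : s * y - y * s = c) (hc : Commute c s) (P : k[X]) :
    aeval s P * y - y * aeval s P = aeval s (derivative P) * c := by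
  induction P using Polynomial.induction_on' with
  | add P Q hP hQ =>
    simp only [map_add, add_mul, mul_add, ← hP, ← hQ]; abel
  | monomial m a =>
    have key : s ^ m * y - y * s ^ m = (m : A) * s ^ (m - 1) * c := by
      induction m with
      | zero => simp
      | succ m ih =>
        have h1 : s ^ (m + 1) * y - y * s ^ (m + 1) =
            s ^ m * (s * y - y * s) + (s ^ m * y - y * s ^ m) * s := by
          rw [pow_succ]; noncomm_ring
        rw [h1, h, ih, mul_assoc _ c s, hc.eq, ← mul_assoc]
        rcases m with _ | m
        · simp
        · simp only [Nat.add_sub_cancel, Nat.cast_succ, pow_succ]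
          noncomm_ring
    rw [aeval_monomial, derivative_monomial, aeval_monomial, mul_assoc, ← mul_assoc y,
      ← Algebra.commutes, mul_assoc, ← mul_sub, key, map_mul, map_natCast]
    simp only [mul_assoc]

theorem Polynomial.Separable.isUnit_aeval_derivative {k A : Type*} [CommRing k] [Ring A]
    [Algebra k A] {P : k[X]} (hP : P.Separable) {s : A} (hs : aeval s P = 0) :
    IsUnit (aeval s (derivative P)) := by
  obtain ⟨a, b, hab⟩ := hP
  have h := congrArg (aeval s) hab
  rw [map_add, map_mul, hs, mul_zero, zero_add, map_mul, map_one] at h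
  refine ⟨⟨_, aeval s b, ?_, h⟩, rfl⟩
  rw [← map_mul, mul_comm, map_mul, h]

/-- The function `q` is the difference quotient of `P` at `s`. When `P'(s)` is invertible,
continuity makes `q x` invertible near `s`, so a nearby commuting root must be `s`. -/
theorem Polynomial.exists_continuous_aeval_sub_eq {k A : Type*} [CommRing k] [Ring A]
    [TopologicalSpace A] [IsTopologicalRing A] [Algebra k A] (s : A) (P : k[X]) :
    ∃ q : A → A, Continuous q ∧ q s = aeval s (derivative P) ∧
      ∀ x, Commute x s → aeval x P - aeval s P = (x - s) * q x := by
  induction P using Polynomial.induction_on' with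
  | add P Q hP hQ =>
    obtain ⟨q, hq, hq1, hq2⟩ := hP
    obtain ⟨r, hr, hr1, hr2⟩ := hQ
    refine ⟨fun x => q x + r x, hq.add hr, by simp [hq1, hr1], fun x hx => ?_⟩
    rw [mul_add, ← hq2 x hx, ← hr2 x hx, map_add, map_add]; abel
  | monomial m a =>
    have key : ∃ q : A → A, Continuous q ∧ q s = (m : A) * s ^ (m - 1) ∧
        ∀ x, Commute x s → x ^ m - s ^ m = (x - s) * q x := by
      induction m with
      | zero => exact ⟨fun _ => 0, continuous_const, by simp, by simp⟩
      | succ m ih =>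
        obtain ⟨q, hq, hq1, hq2⟩ := ih
        refine ⟨fun x => q x * x + s ^ m, (hq.mul continuous_id).add continuous_const, ?_, ?_⟩
        · simp only [hq1]
          rcases m with _ | m
          · simp
          · simp only [Nat.add_sub_cancel, Nat.cast_succ, pow_succ]
            noncomm_ring
        · intro x hx
          have h1 : (x - s) * s ^ m = s ^ m * (x - s) :=
            ((hx.pow_right m).sub_left ((Commute.refl s).pow_right m)).eq
          rw [mul_add, ← mul_assoc, ← hq2 x hx, h1]
          simp only [pow_succ]
          noncomm_ring
    obtain ⟨q, hq, hq1, hq2⟩ := key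
    refine ⟨fun x => algebraMap k A a * q x, continuous_const.mul hq, ?_, fun x hx => ?_⟩
    · simp [hq1, derivative_monomial, aeval_monomial, mul_assoc]
    · rw [aeval_monomial, aeval_monomial, ← mul_sub, hq2 x hx, ← mul_assoc, ← mul_assoc,
        Algebra.commutes]

/-- A zero of a separable polynomial is isolated among the zeros commuting with it. -/
theorem Polynomial.Separable.eventually_eq_of_commute {k A : Type*} [CommRing k] [NormedRing A]
    [HasSummableGeomSeries A] [Algebra k A] {P : k[X]} (hP : P.Separable) {s : A}
    (hs : aeval s P = 0) :
    ∀ᶠ x in nhds s, Commute x s → aeval x P = 0 → x = s := by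
  obtain ⟨q, hq, hq1, hq2⟩ := Polynomial.exists_continuous_aeval_sub_eq s P
  obtain ⟨u, hu⟩ := hP.isUnit_aeval_derivative hs
  have h1 : ∀ᶠ x in nhds s, IsUnit (q x) := by
    apply hq.continuousAt.eventually
    rw [hq1, ← hu]
    exact Units.nhds u
  filter_upwards [h1] with x hx hc h0
  have h2 := hq2 x hc
  rw [h0, hs, sub_zero] at h2
  exact sub_eq_zero.1 ((hx.mul_left_eq_zero).1 h2.symm)

end Rigidity

/-! ### Nearby semisimple elements with the same annihilating polynomial are conjugate. -/

section ConjugacyOpen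

open NormedSpace Filter Topology Polynomial
open scoped Matrix.Norms.Operator

variable {p : ℕ} [Fact p.Prime] {n : ℕ}

namespace LinearAlgebraicGroup

/-- Conjugation by `s`, on the Lie algebra. -/
noncomputable def adjointAction {k : Type} [Field k] (G : LinearAlgebraicGroup k n)
    (s : GL (Fin n) k) (hs : s ∈ G.points k) : G.lieAlgebra →ₗ[k] G.lieAlgebra where
  toFun Z := ⟨(s : Matrix (Fin n) (Fin n) k) * Z *
    ((s⁻¹ : GL (Fin n) k) : Matrix (Fin n) (Fin n) k), conj_mem_lieAlgebra Z.2 hs⟩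
  map_add' Y Z := by ext1; simp [mul_add, add_mul]
  map_smul' c Z := by ext1; simp

/-- Semisimplicity of `s` makes the kernel and range of `1 - Ad s` disjoint: an element of both is a
commutator with `s`, up to the factor `s`, that commutes with `s`, hence zero by the derivation
formula. Counting dimensions, they span `𝔤`. -/
theorem exists_lieAlgebra_decomposition {k : Type} [Field k] {G : LinearAlgebraicGroup k n}
    {s : GL (Fin n) k} (hs : s ∈ G.points k) {P : k[X]} (hP : P.Separable)
    (hsP : aeval (s : Matrix (Fin n) (Fin n) k) P = 0) (Y : G.lieAlgebra) :
    ∃ Z W : G.lieAlgebra, Commute (W : Matrix (Fin n) (Fin n) k) s ∧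
      Z + W - G.adjointAction s hs Z = Y := by
  set L : G.lieAlgebra →ₗ[k] G.lieAlgebra := LinearMap.id - G.adjointAction s hs with hL
  have hker : ∀ W, L W = 0 → Commute (W : Matrix (Fin n) (Fin n) k) s := by
    intro W hW
    have h1 : (W : Matrix (Fin n) (Fin n) k) = s * W *
        ((s⁻¹ : GL (Fin n) k) : Matrix (Fin n) (Fin n) k) :=
      congrArg Subtype.val (sub_eq_zero.1 hW)
    have h2 := congrArg (· * (s : Matrix (Fin n) (Fin n) k)) h1
    simp only [mul_assoc, Units.inv_mul, mul_one] at h2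
    exact h2
  have hdisj : Disjoint (LinearMap.ker L) (LinearMap.range L) := by
    rw [Submodule.disjoint_def]
    rintro W hW ⟨Z, rfl⟩
    have hc := hker _ hW
    have h1 : ((L Z : G.lieAlgebra) : Matrix (Fin n) (Fin n) k) = Z - s * Z *
        ((s⁻¹ : GL (Fin n) k) : Matrix (Fin n) (Fin n) k) := rfl
    set W : Matrix (Fin n) (Fin n) k := ((L Z : G.lieAlgebra) : Matrix (Fin n) (Fin n) k)
    have h2 : (s : Matrix (Fin n) (Fin n) k) * Z - Z * s = -(W * s) := by
      rw [h1, sub_mul, mul_assoc (_ * _), Units.inv_mul]; simp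
    have h3 := Polynomial.aeval_mul_sub_mul_aeval_of_commute h2
      ((hc.mul_left (Commute.refl _)).neg_left) P
    rw [hsP, zero_mul, mul_zero, sub_zero] at h3
    have h4 := (hP.isUnit_aeval_derivative hsP).mul_right_eq_zero.1 h3.symm
    have h5 : W = 0 := by
      simpa using h4
    exact Subtype.ext h5
  have htop : LinearMap.ker L ⊔ LinearMap.range L = ⊤ :=
    Submodule.eq_top_of_disjoint _ _ (by rw [add_comm, LinearMap.finrank_range_add_finrank_ker])
      hdisj
  obtain ⟨W, hW, _, ⟨Z, rfl⟩, h⟩ := Submodule.mem_sup.1 (htop ▸ Submodule.mem_top : Y ∈ _)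
  refine ⟨Z, W, hker W hW, ?_⟩
  rw [← h, hL]
  simp only [LinearMap.sub_apply, LinearMap.id_apply]
  abel

end LinearAlgebraicGroup

end ConjugacyOpen

section ConjugacyOpen

open NormedSpace Filter Topology Polynomial

theorem SemiconjBy.aeval {k A : Type*} [CommRing k] [Ring A] [Algebra k A] {a x y : A}
    (h : SemiconjBy a x y) (P : k[X]) : SemiconjBy a (aeval x P) (aeval y P) := by
  induction P using Polynomial.induction_on' with
  | add P Q hP hQ => simpa using hP.add_right hQ
  | monomial m c =>
    simp only [aeval_monomial]
    exact SemiconjBy.mul_right (Algebra.commutes c a).symm (h.pow_right m)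

section Abstract

variable {p : ℕ} [Fact p.Prime] {𝔸 : Type*} [NormedRing 𝔸] [NormedAlgebra ℚ_[p] 𝔸]
  [CompleteSpace 𝔸]

theorem exists_hasStrictFDerivAt_exp_conj {V : Type*} [NormedAddCommGroup V]
    [NormedSpace ℚ_[p] V] (A B : V →L[ℚ_[p]] 𝔸) (u : 𝔸ˣ) :
    ∃ D : V →L[ℚ_[p]] 𝔸,
      HasStrictFDerivAt (fun v => exp (A v) * exp (B v) * u * exp (-(A v)) * (u⁻¹ : 𝔸ˣ)) D 0 ∧
      ∀ v, D v = A v + B v - u * A v * (u⁻¹ : 𝔸ˣ) := by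
  have h : ∀ C : V →L[ℚ_[p]] 𝔸, HasStrictFDerivAt (fun v => exp (C v)) C 0 := by
    intro C
    have h1 : HasStrictFDerivAt (exp : 𝔸 → 𝔸) (ContinuousLinearMap.id ℚ_[p] 𝔸) (C 0) := by
      rw [map_zero]; exact hasStrictFDerivAt_padicExp
    exact h1.comp (0 : V) C.hasStrictFDerivAt
  have hA := h A
  have hB := h B
  have hN : HasStrictFDerivAt (fun v => exp (-(A v))) (-A) 0 := h (-A)
  have hu : HasStrictFDerivAt (fun _ : V => (u : 𝔸)) (0 : V →L[ℚ_[p]] 𝔸) 0 :=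
    hasStrictFDerivAt_const _ _
  have hu' : HasStrictFDerivAt (fun _ : V => ((u⁻¹ : 𝔸ˣ) : 𝔸)) (0 : V →L[ℚ_[p]] 𝔸) 0 :=
    hasStrictFDerivAt_const _ _
  refine ⟨_, (((hA.mul' hB).mul' hu).mul' hN).mul' hu', fun v => ?_⟩
  simp [mul_assoc]
  abel

variable [FiniteDimensional ℚ_[p] 𝔸]

/-- The derivative at `0` is `(Z, W) ↦ Z + W - Ad s Z`, surjective onto `𝔤` by `hdec`, so the map is
open at `0`. Composing with the projection `π` gives it target `𝔤` before the logarithm is known to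
take values there. -/
theorem map_nhds_exp_conj (𝔤 𝔠 : Submodule ℚ_[p] 𝔸) (s : 𝔸ˣ)
    (hdec : ∀ Y ∈ 𝔤, ∃ Z ∈ 𝔤, ∃ W ∈ 𝔠, Z + W - s * Z * (s⁻¹ : 𝔸ˣ) = Y)
    {log : 𝔸 → 𝔸} (hlog : HasStrictFDerivAt log (ContinuousLinearMap.id ℚ_[p] _) 1)
    (hlog1 : log 1 = 0) (π : 𝔸 →L[ℚ_[p]] 𝔤) (hπ : ∀ Y : 𝔤, π Y = Y) :
    map (fun v : 𝔤 × 𝔠 => π (log (exp (v.1 : 𝔸) * exp (v.2 : 𝔸) * s * exp (-(v.1 : 𝔸)) *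
      (s⁻¹ : 𝔸ˣ)))) (𝓝 0) = 𝓝 0 := by
  have _ : CompleteSpace 𝔤 := FiniteDimensional.complete ℚ_[p] _
  have _ : CompleteSpace 𝔠 := FiniteDimensional.complete ℚ_[p] _
  obtain ⟨D, hD, hDv⟩ := exists_hasStrictFDerivAt_exp_conj
    (𝔤.subtypeL.comp (ContinuousLinearMap.fst ℚ_[p] 𝔤 𝔠))
    (𝔠.subtypeL.comp (ContinuousLinearMap.snd ℚ_[p] 𝔤 𝔠)) s
  have hD' : HasStrictFDerivAt (fun v : 𝔤 × 𝔠 => exp (v.1 : 𝔸) * exp (v.2 : 𝔸) * s *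
    exp (-(v.1 : 𝔸)) * (s⁻¹ : 𝔸ˣ)) D 0 := hD
  have hlog' : HasStrictFDerivAt (fun x => π (log x)) (π.comp (ContinuousLinearMap.id ℚ_[p] 𝔸))
      ((fun v : 𝔤 × 𝔠 => exp (v.1 : 𝔸) * exp (v.2 : 𝔸) * s *
        exp (-(v.1 : 𝔸)) * (s⁻¹ : 𝔸ˣ)) 0) := by
    have h0 : ((fun v : 𝔤 × 𝔠 => exp (v.1 : 𝔸) * exp (v.2 : 𝔸) * s *
        exp (-(v.1 : 𝔸)) * (s⁻¹ : 𝔸ˣ)) 0) = 1 := by simp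
    rw [h0]
    exact π.hasStrictFDerivAt.comp _ hlog
  have h1 := hlog'.comp (0 : 𝔤 × 𝔠) hD'
  have h2 := h1.map_nhds_eq_of_surj (LinearMap.range_eq_top.2 ?_)
  · simpa [hlog1, Function.comp_def] using h2
  · intro Y
    obtain ⟨Z, hZ, W, hW, h⟩ := hdec Y Y.2
    refine ⟨(⟨Z, hZ⟩, ⟨W, hW⟩), ?_⟩
    change π (D _) = Y
    rw [hDv, ← hπ Y]
    congr 1

/-- Openness of the map `(Z, W) ↦ exp Z exp W s exp(-Z) s⁻¹` in logarithmic coordinates gives `g = k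
w s k⁻¹` with `w` commuting with `s`; rigidity of roots of `P` then removes `w`. -/
theorem eventually_exists_conj_of_exp (Γ : Subgroup 𝔸ˣ) (𝔤 : Submodule ℚ_[p] 𝔸)
    (hexpΓ : ∀ X (hX : X ∈ padicExpBall 𝔸 p), padicExpUnit X hX ∈ Γ ↔ X ∈ 𝔤)
    {s : 𝔸ˣ} (hs : s ∈ Γ) {P : ℚ_[p][X]} (hP : P.Separable) (hsP : aeval (s : 𝔸) P = 0)
    (hdec : ∀ Y ∈ 𝔤, ∃ Z ∈ 𝔤, ∃ W ∈ 𝔤, Commute W (s : 𝔸) ∧ Z + W - s * Z * (s⁻¹ : 𝔸ˣ) = Y)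
    {V : Set 𝔸} (hV : V ∈ 𝓝 1) :
    ∀ᶠ x in 𝓝 (s : 𝔸), ∀ g ∈ Γ, (g : 𝔸) = x → aeval x P = 0 →
      ∃ k ∈ Γ, (k : 𝔸) ∈ V ∧ g = k * s * k⁻¹ := by
  obtain ⟨log, hlog, hlog1, hexplog⟩ := exists_padicLog p 𝔸
  obtain ⟨π₀, hπ₀⟩ := LinearMap.exists_leftInverse_of_injective 𝔤.subtype 𝔤.ker_subtype
  let π : 𝔸 →L[ℚ_[p]] 𝔤 := LinearMap.toContinuousLinearMap π₀
  have hπ : ∀ Y : 𝔤, π Y = Y := fun Y => LinearMap.congr_fun hπ₀ Y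
  let 𝔠 : Submodule ℚ_[p] 𝔸 :=
    𝔤 ⊓ LinearMap.ker (LinearMap.mulRight ℚ_[p] (s : 𝔸) - LinearMap.mulLeft ℚ_[p] (s : 𝔸))
  have h𝔠 : ∀ W, W ∈ 𝔠 ↔ W ∈ 𝔤 ∧ Commute W (s : 𝔸) := fun W => by
    simp [𝔠, sub_eq_zero, Commute, SemiconjBy]
  have hmap := map_nhds_exp_conj 𝔤 𝔠 s (fun Y hY => by
    obtain ⟨Z, hZ, W, hW, hc, h⟩ := hdec Y hY
    exact ⟨Z, hZ, W, (h𝔠 W).2 ⟨hW, hc⟩, h⟩) hlog hlog1 π hπ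
  have hexp := tendsto_padicExp_zero p 𝔸
  have hball := padicExpBall_mem_nhds (p := p) (𝔸 := 𝔸)
  have hlogt : Tendsto log (𝓝 1) (𝓝 0) := by
    simpa [ContinuousAt, hlog1] using hlog.hasFDerivAt.continuousAt
  have t1 : Tendsto (fun v : 𝔤 × 𝔠 => (v.1 : 𝔸)) (𝓝 0) (𝓝 0) :=
    (continuous_subtype_val.comp continuous_fst).tendsto' _ _ rfl
  have t2 : Tendsto (fun v : 𝔤 × 𝔠 => (v.2 : 𝔸)) (𝓝 0) (𝓝 0) :=
    (continuous_subtype_val.comp continuous_snd).tendsto' _ _ rfl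
  have t3 : Tendsto (fun v : 𝔤 × 𝔠 => exp (v.2 : 𝔸) * s) (𝓝 0) (𝓝 (s : 𝔸)) := by
    simpa using (hexp.comp t2).mul_const (s : 𝔸)
  have t4 : Tendsto (fun v : 𝔤 × 𝔠 => exp (v.1 : 𝔸) * exp (v.2 : 𝔸) * s * exp (-(v.1 : 𝔸)) *
      (s⁻¹ : 𝔸ˣ)) (𝓝 0) (𝓝 1) := by
    have h0 : Tendsto (fun v : 𝔤 × 𝔠 => -(v.1 : 𝔸)) (𝓝 0) (𝓝 0) := by simpa using t1.neg
    have h1 := (((hexp.comp t1).mul t3).mul (hexp.comp h0)).mul_const ((s⁻¹ : 𝔸ˣ) : 𝔸)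
    simpa [mul_assoc, Function.comp_def] using h1
  have hgood : ∀ᶠ v : 𝔤 × 𝔠 in 𝓝 0,
      (v.1 : 𝔸) ∈ padicExpBall 𝔸 p ∧ (v.2 : 𝔸) ∈ padicExpBall 𝔸 p ∧ exp (v.1 : 𝔸) ∈ V ∧
      (Commute (exp (v.2 : 𝔸) * s) (s : 𝔸) → aeval (exp (v.2 : 𝔸) * s) P = 0 →
        exp (v.2 : 𝔸) * s = s) ∧
      exp (log (exp (v.1 : 𝔸) * exp (v.2 : 𝔸) * s * exp (-(v.1 : 𝔸)) * (s⁻¹ : 𝔸ˣ))) =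
        exp (v.1 : 𝔸) * exp (v.2 : 𝔸) * s * exp (-(v.1 : 𝔸)) * (s⁻¹ : 𝔸ˣ) ∧
      log (exp (v.1 : 𝔸) * exp (v.2 : 𝔸) * s * exp (-(v.1 : 𝔸)) * (s⁻¹ : 𝔸ˣ)) ∈
        padicExpBall 𝔸 p :=
    (t1.eventually hball).and <| (t2.eventually hball).and <|
      ((hexp.comp t1).eventually hV).and <|
      (t3.eventually (hP.eventually_eq_of_commute hsP)).and <|
      (t4.eventually hexplog).and ((hlogt.comp t4).eventually hball)
  have himg := image_mem_map
    (m := fun v : 𝔤 × 𝔠 => π (log (exp (v.1 : 𝔸) * exp (v.2 : 𝔸) * s * exp (-(v.1 : 𝔸)) *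
      (s⁻¹ : 𝔸ˣ)))) hgood
  rw [hmap] at himg
  have u1 : Tendsto (fun x : 𝔸 => x * (s⁻¹ : 𝔸ˣ)) (𝓝 (s : 𝔸)) (𝓝 1) :=
    (continuous_mul_const _).tendsto' _ _ (Units.mul_inv s)
  have u2 := hlogt.comp u1
  have u3 : Tendsto (fun x : 𝔸 => π (log (x * (s⁻¹ : 𝔸ˣ)))) (𝓝 (s : 𝔸)) (𝓝 0) :=
    (π.continuous.tendsto' 0 0 (map_zero _)).comp u2
  filter_upwards [u1.eventually hexplog, u2.eventually hball, u3.eventually himg]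
    with x hx1 hx2 hx3 g hg hgx hgP
  have e1 : padicExpUnit _ hx2 = g * s⁻¹ := by
    ext1
    rw [Units.val_mul, hgx]
    exact hx1
  have e2 := (hexpΓ _ hx2).1 (by rw [e1]; exact mul_mem hg (inv_mem hs))
  obtain ⟨v, ⟨b1, b2, b3, b4, b5, b6⟩, hv⟩ := hx3
  have hW := (h𝔠 _).1 v.2.2
  have hk := (hexpΓ _ b1).2 v.1.2
  have hw := (hexpΓ _ b2).2 hW.1
  set k := padicExpUnit _ b1 with hk_def
  set w := padicExpUnit _ b2 with hw_def
  have hkv : (k : 𝔸) = exp (v.1 : 𝔸) := rfl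
  have hkv' : ((k⁻¹ : 𝔸ˣ) : 𝔸) = exp (-(v.1 : 𝔸)) := rfl
  have hwv : (w : 𝔸) = exp (v.2 : 𝔸) := rfl
  simp only [← hkv, ← hkv', ← hwv] at b3 b4 b5 b6 hv
  have e3 : padicExpUnit _ b6 = k * w * s * k⁻¹ * s⁻¹ := by
    ext1
    exact b5
  have e4 := (hexpΓ _ b6).1
    (by rw [e3]; exact mul_mem (mul_mem (mul_mem (mul_mem hk hw) hs) (inv_mem hk)) (inv_mem hs))
  -- Both logarithms lie in `𝔤` because their exponentials lie in `Γ`, and `π` is the identity on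
  -- `𝔤`; so equality of projections is equality of logarithms.
  have e5 : (⟨_, e4⟩ : 𝔤) = ⟨_, e2⟩ := by
    rw [← hπ ⟨_, e4⟩, ← hπ ⟨_, e2⟩]
    exact hv
  have e6 : k * w * s * k⁻¹ * s⁻¹ = g * s⁻¹ := by
    rw [← e1, ← e3]
    ext1
    exact congrArg exp (congrArg Subtype.val e5)
  have e7 : w * s = k⁻¹ * g * k := by
    rw [← mul_left_inj (a := s⁻¹), ← mul_right_inj (a := k), ← mul_left_inj (a := k⁻¹)]
    have := mul_right_cancel e6
    rw [← this]; group
  have hws : Commute (w : 𝔸) (s : 𝔸) := by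
    rw [hwv]; exact hW.2.exp_left
  -- As a conjugate of `g`, the element `w s` is killed by `P`; it is close to `s` and commutes with
  -- it.
  have e8 : ((w : 𝔸) * s) = s := by
    refine b4 (hws.mul_left (Commute.refl _)) ?_
    have h1 : SemiconjBy (k : 𝔸) ((w : 𝔸) * s) (g : 𝔸) := by
      have : k * (w * s) = g * k := by rw [e7]; group
      exact congrArg Units.val this
    have h2 := (h1.aeval P).eq
    rw [hgx, hgP, zero_mul] at h2
    exact (k.isUnit.mul_right_eq_zero).1 h2
  refine ⟨k, hk, b3, ?_⟩
  have e9 : w * s = s := Units.ext e8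
  rw [← e9, e7]; group

end Abstract

open scoped Matrix.Norms.Operator

theorem LinearAlgebraicGroup.eventually_exists_conj {p : ℕ} [Fact p.Prime] {n : ℕ}
    {G : LinearAlgebraicGroup ℚ_[p] n} {s : GL (Fin n) ℚ_[p]}
    (hs : s ∈ G.points ℚ_[p]) {P : ℚ_[p][X]} (hP : P.Separable)
    (hsP : aeval (s : Matrix (Fin n) (Fin n) ℚ_[p]) P = 0)
    {V : Set (Matrix (Fin n) (Fin n) ℚ_[p])} (hV : V ∈ 𝓝 1) :
    ∀ᶠ x in 𝓝 (s : Matrix (Fin n) (Fin n) ℚ_[p]), ∀ g ∈ G.points ℚ_[p],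
      (g : Matrix (Fin n) (Fin n) ℚ_[p]) = x → aeval x P = 0 →
      ∃ k ∈ G.points ℚ_[p], (k : Matrix (Fin n) (Fin n) ℚ_[p]) ∈ V ∧ g = k * s * k⁻¹ := by
  refine eventually_exists_conj_of_exp (G.points ℚ_[p]) G.lieAlgebra
    (fun X hX => ⟨mem_lieAlgebra_of_exp_mem hX, padicExpUnit_mem_points hX⟩) hs hP hsP ?_ hV
  intro Y hY
  obtain ⟨Z, W, hW, h⟩ := exists_lieAlgebra_decomposition hs hP hsP ⟨Y, hY⟩
  exact ⟨Z, Z.2, W, W.2, hW, congrArg Subtype.val h⟩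

end ConjugacyOpen

/-! ### Base change of the Lie algebra, and the Lie algebra of a split torus. -/

namespace LinearAlgebraicGroup

section BaseChange

variable {k K : Type} [Field k] [Field K] [Algebra k K] {n : ℕ}

theorem invDerivation_map (X : Matrix (Fin n) (Fin n) k) (f : MvPolynomial (Fin n × Fin n) k) :
    invDerivation (X.map (algebraMap k K)) (MvPolynomial.map (algebraMap k K) f) =
      MvPolynomial.map (algebraMap k K) (invDerivation X f) := by
  induction f using MvPolynomial.induction_on with
  | C a =>
    have h1 : invDerivation X (MvPolynomial.C a) = 0 := (invDerivation X).map_algebraMap a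
    have h2 : invDerivation (X.map (algebraMap k K)) (MvPolynomial.C (algebraMap k K a)) = 0 :=
      (invDerivation _).map_algebraMap _
    rw [h1, MvPolynomial.map_C, h2, map_zero]
  | add f g hf hg => simp only [map_add, hf, hg]
  | mul_X f ij hf =>
    simp only [map_mul, Derivation.leibniz, hf, MvPolynomial.map_X, invDerivation_X, map_add,
      smul_eq_mul, map_sum, MvPolynomial.smul_eq_C_mul, MvPolynomial.map_C, Matrix.map_apply]

theorem derivAtOne_map (X : Matrix (Fin n) (Fin n) k) (f : MvPolynomial (Fin n × Fin n) k) :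
    derivAtOne (MvPolynomial.map (algebraMap k K) f) (X.map (algebraMap k K)) =
      algebraMap k K (derivAtOne f X) := by
  simp only [derivAtOne, LinearMap.coe_mk, AddHom.coe_mk, invDerivation_map]
  rw [MvPolynomial.eval_map, MvPolynomial.eval₂_comp]
  congr 1
  funext ij
  simp [Matrix.one_apply, apply_ite (algebraMap k K)]

theorem mem_points_baseChange_iff (T : LinearAlgebraicGroup k n) {R : Type} [CommRing R]
    [Algebra k R] [Algebra K R] [IsScalarTower k K R] (g : GL (Fin n) R) :
    g ∈ (T.baseChange K).points R ↔ g ∈ T.points R :=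
  vanishes_map_iff T.eqs g

theorem map_mem_lieAlgebra_baseChange {T : LinearAlgebraicGroup k n}
    {X : Matrix (Fin n) (Fin n) k} (hX : X ∈ T.lieAlgebra) :
    X.map (algebraMap k K) ∈ (T.baseChange K).lieAlgebra := by
  rw [mem_lieAlgebra]
  rintro _ ⟨f, hf, rfl⟩
  rw [derivAtOne_map, mem_lieAlgebra.1 hX f hf, map_zero]

/-- The Lie algebra commutes with base change, in terms of linear functionals. -/
theorem eq_zero_on_lieAlgebra_baseChange (T : LinearAlgebraicGroup k n)
    (φ : Matrix (Fin n) (Fin n) K →ₗ[K] K)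
    (hφ : ∀ X ∈ T.lieAlgebra, φ (X.map (algebraMap k K)) = 0)
    {Y : Matrix (Fin n) (Fin n) K} (hY : Y ∈ (T.baseChange K).lieAlgebra) : φ Y = 0 := by
  classical
  -- Expand the entries of `Y` in a `k`-basis of `K`. The equations have coefficients in `k`, so
  -- each coefficient matrix of `Y` already lies in the Lie algebra over `k`.
  let b := Module.Basis.ofVectorSpace k K
  let I : Finset _ := Finset.univ.biUnion fun ij : Fin n × Fin n => (b.repr (Y ij.1 ij.2)).support
  let X : _ → Matrix (Fin n) (Fin n) k := fun c => Matrix.of fun i j => b.repr (Y i j) c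
  have hYX : Y = ∑ c ∈ I, b c • (X c).map (algebraMap k K) := by
    ext i j
    rw [Matrix.sum_apply]
    conv_lhs => rw [← b.linearCombination_repr (Y i j), Finsupp.linearCombination_apply]
    rw [Finsupp.sum_of_support_subset (s := I)]
    · refine Finset.sum_congr rfl fun c _ => ?_
      simp [X, Algebra.smul_def, mul_comm]
    · exact Finset.subset_biUnion_of_mem (fun ij : Fin n × Fin n =>
        (b.repr (Y ij.1 ij.2)).support) (Finset.mem_univ (i, j))
    · simp
  have hX : ∀ c ∈ I, X c ∈ T.lieAlgebra := by
    intro c hc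
    rw [mem_lieAlgebra]
    intro f hf
    have h1 := mem_lieAlgebra.1 hY _ ⟨f, hf, rfl⟩
    rw [hYX, map_sum] at h1
    simp only [map_smul, derivAtOne_map, smul_eq_mul] at h1
    have h2 : ∑ c ∈ I, derivAtOne f (X c) • b c = 0 := by
      rw [← h1]
      exact Finset.sum_congr rfl fun c _ => by rw [Algebra.smul_def, mul_comm]
    exact linearIndependent_iff'.1 b.linearIndependent I _ h2 c hc
  rw [hYX, map_sum]
  refine Finset.sum_eq_zero fun c hc => ?_
  rw [map_smul, hφ _ (hX c hc), smul_zero]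

end BaseChange

section Weights

variable {K : Type} [Field K] {n : ℕ}

/-- The unit `1 + c ε`, as a homomorphism from the additive group. -/
noncomputable def dualUnit (K : Type) [Field K] : Multiplicative K →* (DualNumber K)ˣ where
  toFun c :=
    { val := 1 + c.toAdd • DualNumber.eps
      inv := 1 - c.toAdd • DualNumber.eps
      val_inv := by
        rw [add_mul, one_mul, mul_sub, mul_one, smul_mul_smul_comm, DualNumber.eps_mul_eps,
          smul_zero]; abel
      inv_val := by
        rw [sub_mul, one_mul, mul_add, mul_one, smul_mul_smul_comm, DualNumber.eps_mul_eps,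
          smul_zero]; abel }
  map_one' := by ext <;> simp
  map_mul' c d := by
    ext1
    rw [Units.val_mul]
    simp only [toAdd_mul]
    rw [add_mul, one_mul, mul_add, mul_one, smul_mul_smul_comm, DualNumber.eps_mul_eps, smul_zero,
      add_smul]
    abel

theorem dualUnit_coe (c : K) :
    (dualUnit K (Multiplicative.ofAdd c) : DualNumber K) = 1 + c • DualNumber.eps := rfl

namespace WeightDecomposition

variable {S : LinearAlgebraicGroup K n} (D : S.WeightDecomposition)

theorem P_mul (a b : Fin D.r → ℤ) : D.P a * D.P b = if a = b then D.P a else 0 := by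
  split_ifs with h
  · rw [← h, D.P_mul_self]
  · exact D.P_mul_of_ne a b h

theorem sum_smul_P_mul (c : (Fin D.r → ℤ) → K) {a : Fin D.r → ℤ} (ha : a ∈ D.weights) :
    (∑ b ∈ D.weights, c b • D.P b) * D.P a = c a • D.P a := by
  simp [Finset.sum_mul, P_mul, ha]

theorem P_mul_sum_smul (c : (Fin D.r → ℤ) → K) {a : Fin D.r → ℤ} (ha : a ∈ D.weights) :
    D.P a * (∑ b ∈ D.weights, c b • D.P b) = c a • D.P a := by
  simp [Finset.mul_sum, P_mul, ha]

theorem exists_eq_sum_of_mem_lieAlgebra {Y : Matrix (Fin n) (Fin n) K} (hY : Y ∈ S.lieAlgebra) :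
    ∃ c : (Fin D.r → ℤ) → K, Y = ∑ a ∈ D.weights, c a • D.P a := by
  have h := oneAddSmul_mem_points hY (DualNumber K) DualNumber.eps DualNumber.eps_mul_eps
  have h1 := D.coe_eq (DualNumber K) ⟨_, h⟩
  refine ⟨fun a => TrivSqZeroExt.snd
    (weightChar (D.e (DualNumber K) ⟨_, h⟩) a : DualNumber K), ?_⟩
  ext i j
  have h2 := congrArg TrivSqZeroExt.snd (congrFun (congrFun h1 i) j)
  simp only [Matrix.sum_apply, Matrix.smul_apply, Matrix.map_apply,
    Matrix.GeneralLinearGroup.oneAddSmul, Matrix.add_apply, TrivSqZeroExt.snd_add,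
    TrivSqZeroExt.snd_sum, TrivSqZeroExt.algebraMap_eq_inl, smul_eq_mul,
    TrivSqZeroExt.snd_mul] at h2 ⊢
  have h3 : TrivSqZeroExt.snd ((1 : Matrix (Fin n) (Fin n) (DualNumber K)) i j) = 0 := by
    rw [Matrix.one_apply]; split_ifs <;> simp
  rw [h3] at h2
  simpa [mul_comm] using h2

/-- This is the derivative of the `i`-th coordinate cocharacter: at the point with `i`-th coordinate
`1 + ε` and the others `1`, the weight `a` takes the value `1 + a i ε`. -/
theorem sum_weight_smul_P_mem_lieAlgebra (i : Fin D.r) :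
    ∑ a ∈ D.weights, (a i : K) • D.P a ∈ S.lieAlgebra := by
  apply mem_lieAlgebra_of_dualNumber
  let s : Fin D.r → (DualNumber K)ˣ := Pi.mulSingle i (dualUnit K (Multiplicative.ofAdd 1))
  let t := (D.e (DualNumber K)).symm s
  have hs : ∀ a, (weightChar s a : DualNumber K) = 1 + (a i : K) • DualNumber.eps := by
    intro a
    have h1 : weightChar s a = dualUnit K (Multiplicative.ofAdd (a i : K)) := by
      rw [weightChar, Finset.prod_eq_single i]
      · simp only [s, Pi.mulSingle_eq_same]
        rw [← map_zpow, ← ofAdd_zsmul, zsmul_one]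
      · intro j _ hj
        simp only [s, Pi.mulSingle_eq_of_ne hj, one_zpow]
      · simp
    rw [h1, dualUnit_coe]
  have h1 := D.coe_eq (DualNumber K) t
  simp only [t, MulEquiv.apply_symm_apply, hs] at h1
  convert t.2 using 1
  ext1
  rw [h1]
  have h2 : (1 : Matrix (Fin n) (Fin n) (DualNumber K)) =
      ∑ a ∈ D.weights, (D.P a).map (algebraMap K (DualNumber K)) := by
    rw [← map_one (algebraMap K (DualNumber K)).mapMatrix, ← D.sum_P, map_sum]
    rfl
  simp only [Matrix.GeneralLinearGroup.oneAddSmul]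
  rw [h2]
  simp only [add_smul, one_smul, Finset.sum_add_distrib]
  congr 1
  ext1 i j
  simp only [Matrix.smul_apply, Matrix.map_apply, Matrix.sum_apply, smul_eq_mul, map_sum, map_mul,
    Finset.mul_sum]
  simp only [Algebra.smul_def]
  exact Finset.sum_congr rfl fun a _ => by ring

/-- The coefficient of `P a`, as a linear functional. -/
theorem exists_coeff_functional {a : Fin D.r → ℤ} (ha : a ∈ D.weights) :
    ∃ φ : Matrix (Fin n) (Fin n) K →ₗ[K] K,
      ∀ c : (Fin D.r → ℤ) → K, φ (∑ b ∈ D.weights, c b • D.P b) = c a := by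
  have h : ∃ i j, D.P a i j ≠ 0 := by
    by_contra! h
    exact D.P_ne_zero a ha (Matrix.ext h)
  obtain ⟨i, j, hij⟩ := h
  refine ⟨(D.P a i j)⁻¹ • (Matrix.entryLinearMap K K i j).comp (LinearMap.mulRight K (D.P a)),
    fun c => ?_⟩
  rw [LinearMap.smul_apply, LinearMap.comp_apply, LinearMap.mulRight_apply, D.sum_smul_P_mul c ha]
  simp
  field_simp

/-- Comparing the two products between `P a` and `P b` gives `(c a - c b) P a g P b = 0`. Distinct
eigenvalues make `g` block diagonal for the weight spaces. -/
theorem commute_P_of_commute {g : Matrix (Fin n) (Fin n) K} {c : (Fin D.r → ℤ) → K}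
    (hc : Set.InjOn c D.weights) (hg : Commute g (∑ b ∈ D.weights, c b • D.P b))
    {a : Fin D.r → ℤ} (ha : a ∈ D.weights) : Commute g (D.P a) := by
  have h0 : ∀ a ∈ D.weights, ∀ b ∈ D.weights, a ≠ b → D.P a * g * D.P b = 0 := by
    intro a ha b hb hab
    have h1 : D.P a * ((∑ b ∈ D.weights, c b • D.P b) * g) * D.P b =
        D.P a * (g * ∑ b ∈ D.weights, c b • D.P b) * D.P b := by rw [hg.eq]
    rw [← mul_assoc, D.P_mul_sum_smul c ha, mul_assoc (D.P a), mul_assoc g, D.sum_smul_P_mul c hb,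
      smul_mul_assoc, smul_mul_assoc, mul_smul_comm, mul_smul_comm, ← mul_assoc] at h1
    have h2 : (c a - c b) • (D.P a * g * D.P b) = 0 := by rw [sub_smul, h1, sub_self]
    exact (smul_eq_zero.1 h2).resolve_left (sub_ne_zero.2 fun h => hab (hc ha hb h))
  have h1 : g * D.P a = D.P a * g * D.P a := by
    conv_lhs => rw [← one_mul g, ← D.sum_P, Finset.sum_mul, Finset.sum_mul]
    rw [Finset.sum_eq_single_of_mem a ha]
    exact fun b hb hba => h0 b hb a ha hba
  have h2 : D.P a * g = D.P a * g * D.P a := by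
    conv_lhs => rw [← mul_one (D.P a * g), ← D.sum_P, Finset.mul_sum]
    rw [Finset.sum_eq_single_of_mem a ha]
    exact fun b hb hba => h0 a ha b hb hba.symm
  exact h1.trans h2.symm

theorem coe_mul_comm_of_commute_P {R : Type} [CommRing R] [Algebra K R] (t : S.points R)
    (g : GL (Fin n) R) (hg : ∀ a ∈ D.weights,
      Commute (g : Matrix (Fin n) (Fin n) R) ((D.P a).map (algebraMap K R))) :
    (t : GL (Fin n) R) * g = g * t := by
  ext1
  rw [Units.val_mul, Units.val_mul, D.coe_eq R t, Finset.sum_mul, Finset.mul_sum]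
  refine Finset.sum_congr rfl fun a ha => ?_
  rw [smul_mul_assoc, mul_smul_comm, (hg a ha).eq]

end WeightDecomposition

end Weights

end LinearAlgebraicGroup

/-! ### Regular elements, their centralizers and annihilating polynomials. -/

section BaseChange

open Polynomial

theorem Matrix.commute_map {n k R : Type*} [Fintype n] [DecidableEq n] [CommRing k] [CommRing R]
    [Algebra k R] {A B : Matrix n n k} (h : Commute A B) :
    Commute (A.map (algebraMap k R)) (B.map (algebraMap k R)) :=
  Commute.map h (algebraMap k R).mapMatrix

theorem Matrix.GeneralLinearGroup.map_injective_of_injective {n : ℕ} {R S : Type*} [CommRing R]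
    [CommRing S] {f : R →+* S} (hf : Function.Injective f) :
    Function.Injective (Matrix.GeneralLinearGroup.map (n := Fin n) f) := by
  intro g h hgh
  ext i j
  exact hf (congrFun (congrFun
    (congrArg (fun z : GL (Fin n) S => (z : Matrix (Fin n) (Fin n) S)) hgh) i) j)

namespace LinearAlgebraicGroup

variable {k K : Type} [Field k] [Field K] [Algebra k K] {n : ℕ}

/-- The homomorphism `T(k) → T_K(K)`. -/
noncomputable def toBaseChange (T : LinearAlgebraicGroup k n) (K : Type) [Field K] [Algebra k K] :
    T.points k →* (T.baseChange K).points K :=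
  ((Matrix.GeneralLinearGroup.map (algebraMap k K)).comp (T.points k).subtype).codRestrict _
    (fun t => (T.mem_points_baseChange_iff _).2 (T.map_mem_points (Algebra.ofId k K) t.2))

theorem toBaseChange_coe (T : LinearAlgebraicGroup k n) (t : T.points k) :
    ((T.toBaseChange K t : GL (Fin n) K) : Matrix (Fin n) (Fin n) K) =
      ((t : GL (Fin n) k) : Matrix (Fin n) (Fin n) k).map (algebraMap k K) := rfl

namespace WeightDecomposition

variable {T : LinearAlgebraicGroup k n} (D : (T.baseChange K).WeightDecomposition)

/-- The Lie algebra of a torus contains an element on which all weights take distinct values. -/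
theorem exists_regular_mem_lieAlgebra [CharZero k] : ∃ X ∈ T.lieAlgebra,
    ∃ c : (Fin D.r → ℤ) → K, Set.InjOn c D.weights ∧
      X.map (algebraMap k K) = ∑ a ∈ D.weights, c a • D.P a := by
  classical
  have _ : CharZero K := charZero_of_injective_algebraMap (algebraMap k K).injective
  have hφ : ∀ a : D.weights, ∃ φ : Matrix (Fin n) (Fin n) K →ₗ[K] K,
      ∀ c : (Fin D.r → ℤ) → K, φ (∑ b ∈ D.weights, c b • D.P b) = c a :=
    fun a => D.exists_coeff_functional a.2
  choose φ hφ using hφ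
  let ψ : {ab : D.weights × D.weights // ab.1 ≠ ab.2} → T.lieAlgebra →ₗ[k] K := fun ab =>
    (((φ ab.1.1 - φ ab.1.2).restrictScalars k).comp (Algebra.linearMap k K).mapMatrix).comp
      T.lieAlgebra.subtype
  -- A difference of two weights vanishing on the Lie algebra over `k` would vanish over `K`, yet on
  -- the `i`-th cocharacter derivative it equals `a i - b i`. Finitely many proper subspaces over
  -- the infinite field `k` then leave out some `X`.
  have hψ : ∀ ab, LinearMap.ker (ψ ab) ≠ ⊤ := by
    rintro ⟨⟨a, b⟩, hab⟩ h
    have h1 : ∀ X ∈ T.lieAlgebra, (φ a - φ b) (X.map (algebraMap k K)) = 0 := by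
      intro X hX
      have : (⟨X, hX⟩ : T.lieAlgebra) ∈ LinearMap.ker (ψ ⟨(a, b), hab⟩) := h ▸ Submodule.mem_top
      exact LinearMap.mem_ker.1 this
    obtain ⟨i, hi⟩ := Function.ne_iff.1 (fun h => hab (Subtype.ext h) : (a : Fin D.r → ℤ) ≠ b)
    have h2 := T.eq_zero_on_lieAlgebra_baseChange _ h1 (D.sum_weight_smul_P_mem_lieAlgebra i)
    rw [LinearMap.sub_apply, hφ a (fun a => (a i : K)), hφ b (fun a => (a i : K)), sub_eq_zero] at h2
    exact hi (by exact_mod_cast h2)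
  obtain ⟨X, hX⟩ := Submodule.exists_forall_notMem_of_forall_ne_top _ hψ
  obtain ⟨c, hc⟩ := D.exists_eq_sum_of_mem_lieAlgebra (map_mem_lieAlgebra_baseChange X.2)
  refine ⟨X, X.2, c, fun a ha b hb hab => ?_, hc⟩
  by_contra hne
  apply hX ⟨(⟨a, ha⟩, ⟨b, hb⟩), fun h => hne (congrArg Subtype.val h)⟩
  rw [LinearMap.mem_ker]
  change (φ _ - φ _) ((X : Matrix (Fin n) (Fin n) k).map (algebraMap k K)) = 0
  rw [hc, LinearMap.sub_apply, hφ, hφ, sub_eq_zero]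
  exact hab

/-- The projections `P a` are defined over `K`, while `t` lives over `R`. The comparison takes place
over `K ⊗ R`, into which `R` injects. -/
theorem mem_centralizerPoints_of_commute (G : LinearAlgebraicGroup k n)
    {X : Matrix (Fin n) (Fin n) k} {c : (Fin D.r → ℤ) → K} (hc : Set.InjOn c D.weights)
    (hX : X.map (algebraMap k K) = ∑ a ∈ D.weights, c a • D.P a) (g : G.points k)
    (hg : Commute ((g : GL (Fin n) k) : Matrix (Fin n) (Fin n) k) X) :
    g ∈ G.centralizerPoints T := by
  have h1 := Matrix.commute_map (R := K) hg
  rw [hX] at h1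
  intro R _ _ t ht
  let ι : R →ₐ[k] TensorProduct k K R := Algebra.TensorProduct.includeRight
  have hι : Function.Injective ι :=
    Algebra.TensorProduct.includeRight_injective (algebraMap k K).injective
  apply Matrix.GeneralLinearGroup.map_injective_of_injective (f := (ι : R →+* TensorProduct k K R))
    (fun x y h => hι h)
  have ht' : Matrix.GeneralLinearGroup.map (ι : R →+* TensorProduct k K R) t ∈
      (T.baseChange K).points (TensorProduct k K R) :=
    (T.mem_points_baseChange_iff _).2 (T.map_mem_points ι ht)
  have h2 := D.coe_mul_comm_of_commute_P ⟨_, ht'⟩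
    (Matrix.GeneralLinearGroup.map (ι : R →+* TensorProduct k K R)
      (Matrix.GeneralLinearGroup.map (algebraMap k R) (g : GL (Fin n) k))) (fun a ha => ?_)
  · rw [map_mul, map_mul]
    exact h2
  · have h3 := Matrix.commute_map (R := TensorProduct k K R) (D.commute_P_of_commute hc h1 ha)
    convert h3 using 1
    ext i j
    change ι (algebraMap k R _) = algebraMap K _ (algebraMap k K _)
    rw [ι.commutes, ← IsScalarTower.algebraMap_apply]

theorem aeval_sum_smul_P_mul (c : (Fin D.r → ℤ) → K) {a : Fin D.r → ℤ} (ha : a ∈ D.weights)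
    (Q : k[X]) : aeval (∑ b ∈ D.weights, c b • D.P b) Q * D.P a = aeval (c a) Q • D.P a := by
  induction Q using Polynomial.induction_on with
  | C r => simp [Algebra.smul_def, IsScalarTower.algebraMap_apply k K (Matrix (Fin n) (Fin n) K)]
  | add P Q hP hQ => simp only [map_add, add_mul, add_smul, hP, hQ]
  | monomial m r h =>
    rw [pow_succ, ← mul_assoc, map_mul (aeval _) (_ * _), map_mul (aeval (c a)) (_ * _), aeval_X,
      aeval_X, mul_assoc,
      D.sum_smul_P_mul c ha, mul_smul_comm, h, smul_smul, mul_comm]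

/-- The eigenvalues `c a` are algebraic over `k`. The radical of the product of their minimal
polynomials kills `M` and is squarefree, hence separable in characteristic zero. -/
theorem exists_separable_aeval_eq_zero [CharZero k] [Algebra.IsAlgebraic k K]
    {M : Matrix (Fin n) (Fin n) k} {c : (Fin D.r → ℤ) → K}
    (hM : M.map (algebraMap k K) = ∑ a ∈ D.weights, c a • D.P a) :
    ∃ Q : k[X], Q.Separable ∧ aeval M Q = 0 := by
  classical
  have hint : ∀ a, IsIntegral k (c a) := fun a => Algebra.IsIntegral.isIntegral _
  let N : k[X] := ∏ a ∈ D.weights, minpoly k (c a)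
  have hN : N ≠ 0 := Finset.prod_ne_zero_iff.2 fun a _ => minpoly.ne_zero (hint a)
  refine ⟨UniqueFactorizationMonoid.radical N, PerfectField.separable_iff_squarefree.2
    UniqueFactorizationMonoid.squarefree_radical, ?_⟩
  have h1 : ∀ a ∈ D.weights, aeval (c a) (UniqueFactorizationMonoid.radical N) = 0 := by
    intro a ha
    have h2 : minpoly k (c a) ∣ UniqueFactorizationMonoid.radical N :=
      (UniqueFactorizationMonoid.dvd_radical_iff_of_irreducible (minpoly.irreducible (hint a)) hN).2
        (Finset.dvd_prod_of_mem _ ha)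
    obtain ⟨q, hq⟩ := h2
    rw [hq, map_mul, minpoly.aeval, zero_mul]
  have h2 : aeval (M.map (algebraMap k K)) (UniqueFactorizationMonoid.radical N) = 0 := by
    rw [hM, ← mul_one (aeval _ _), ← D.sum_P, Finset.mul_sum]
    refine Finset.sum_eq_zero fun a ha => ?_
    rw [D.aeval_sum_smul_P_mul c ha, h1 a ha, zero_smul]
  have h3 : aeval (M.map (algebraMap k K)) (UniqueFactorizationMonoid.radical N) =
      (aeval M (UniqueFactorizationMonoid.radical N)).map (algebraMap k K) :=
    Polynomial.aeval_algHom_apply (Algebra.ofId k K).mapMatrix M _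
  rw [h3] at h2
  ext i j
  exact (algebraMap k K).injective ((congrFun (congrFun h2 i) j).trans (map_zero _).symm)

end WeightDecomposition

end LinearAlgebraicGroup

end BaseChange

/-! ### Bounded points of a torus and its maximal compact subgroup. -/

section Bounded

open Filter Topology

theorem Units.isClosedEmbedding_embedProduct' {M : Type*} [TopologicalSpace M] [Monoid M]
    [ContinuousMul M] [T2Space M] : IsClosedEmbedding (Units.embedProduct M) := by
  refine ⟨Units.isEmbedding_embedProduct, ?_⟩
  have h : Set.range (Units.embedProduct M) =
      {x : M × Mᵐᵒᵖ | x.1 * x.2.unop = 1} ∩ {x | x.2.unop * x.1 = 1} := by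
    ext x
    constructor
    · rintro ⟨u, rfl⟩
      simp
    · rintro ⟨h1, h2⟩
      exact ⟨⟨x.1, x.2.unop, h1, h2⟩, rfl⟩
  rw [h]
  exact (isClosed_eq (continuous_fst.mul (MulOpposite.continuous_unop.comp continuous_snd))
    continuous_const).inter
    (isClosed_eq ((MulOpposite.continuous_unop.comp continuous_snd).mul continuous_fst)
    continuous_const)

variable {k : Type} [NormedField k] {n : ℕ}

theorem Matrix.isCompact_setOf_norm_le [ProperSpace k] (C : ℝ) :
    IsCompact {A : Matrix (Fin n) (Fin n) k | ∀ i j, ‖A i j‖ ≤ C} := by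
  have h : {A : Matrix (Fin n) (Fin n) k | ∀ i j, ‖A i j‖ ≤ C} =
      Set.univ.pi fun _ : Fin n => Set.univ.pi fun _ : Fin n => Metric.closedBall (0 : k) C := by
    ext A
    exact ⟨fun h i _ j _ => by simpa using h i j, fun h i j => by simpa using h i trivial j trivial⟩
  rw [h]
  exact isCompact_univ_pi fun _ => isCompact_univ_pi fun _ => isCompact_closedBall _ _

theorem Matrix.GeneralLinearGroup.continuous_entry (i j : Fin n) :
    Continuous fun g : GL (Fin n) k => g i j :=
  Continuous.matrix_elem (Units.continuous_val (M := Matrix (Fin n) (Fin n) k)) i j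

theorem Matrix.GeneralLinearGroup.isCompact_setOf_norm_le [ProperSpace k] (C : ℝ) :
    IsCompact {g : GL (Fin n) k | (∀ i j, ‖g i j‖ ≤ C) ∧ ∀ i j, ‖g⁻¹ i j‖ ≤ C} := by
  have h1 := Matrix.isCompact_setOf_norm_le (k := k) (n := n) C
  have h2 := h1.prod (h1.image MulOpposite.continuous_op)
  have h3 := (Units.isClosedEmbedding_embedProduct'
    (M := Matrix (Fin n) (Fin n) k)).isCompact_preimage h2
  convert h3 using 1
  ext g
  simp only [Set.mem_ofPred_eq, Set.mem_preimage, Set.mem_prod, Units.embedProduct_apply,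
    Set.mem_image, MulOpposite.op_inj, exists_eq_right]

namespace LinearAlgebraicGroup

theorem isClosed_points (G : LinearAlgebraicGroup k n) :
    IsClosed (G.points k : Set (GL (Fin n) k)) := by
  have h : (G.points k : Set (GL (Fin n) k)) = ⋂ f ∈ G.eqs,
      {g | MvPolynomial.eval (fun ij : Fin n × Fin n => g ij.1 ij.2) f = 0} := by
    ext g
    simp only [Set.mem_iInter, Set.mem_ofPred_eq]
    exact forall₂_congr fun f _ => by rw [MvPolynomial.aeval_eq_eval]
  rw [h]
  refine isClosed_biInter fun f _ => isClosed_eq ?_ continuous_const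
  exact (MvPolynomial.continuous_eval f).comp (continuous_pi fun ij =>
    Matrix.GeneralLinearGroup.continuous_entry ij.1 ij.2)

variable {K : Type} [NormedField K] [NormedAlgebra k K]

namespace WeightDecomposition

variable {T : LinearAlgebraicGroup k n} (D : (T.baseChange K).WeightDecomposition)

/-- The value of the weight `a` at `t ∈ T(k)`. -/
noncomputable def weightValue (a : Fin D.r → ℤ) : T.points k →* Kˣ where
  toFun t := weightChar (D.e K (T.toBaseChange K t)) a
  map_one' := by rw [map_one, map_one, weightChar_one]
  map_mul' t u := by rw [map_mul, map_mul, weightChar_mul]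

theorem map_coe_eq (t : T.points k) :
    ((t : GL (Fin n) k) : Matrix (Fin n) (Fin n) k).map (algebraMap k K) =
      ∑ a ∈ D.weights, (D.weightValue a t : K) • D.P a := by
  rw [← T.toBaseChange_coe, D.coe_eq]
  refine Finset.sum_congr rfl fun a _ => ?_
  congr 1

/-- The subgroup of `T(k)` on which all weights have absolute value `1`. -/
noncomputable def compactPart : Subgroup (T.points k) where
  carrier := {t | ∀ a ∈ D.weights, ‖(D.weightValue a t : K)‖ = 1}
  one_mem' a _ := by rw [map_one]; simp
  mul_mem' {t u} ht hu a ha := by rw [map_mul, Units.val_mul, norm_mul, ht a ha, hu a ha, one_mul]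
  inv_mem' {t} ht a ha := by
    rw [map_inv, Units.val_inv_eq_inv_val, norm_inv, ht a ha, inv_one]

theorem exists_bound_compactPart : ∃ C : ℝ, ∀ t ∈ D.compactPart, ∀ i j,
    ‖((t : T.points k) : GL (Fin n) k) i j‖ ≤ C := by
  refine ⟨∑ i, ∑ j, ∑ a ∈ D.weights, ‖D.P a i j‖, fun t ht i j => ?_⟩
  have h1 := congrFun (congrFun (D.map_coe_eq t) i) j
  rw [Matrix.map_apply, Matrix.sum_apply] at h1
  rw [← norm_algebraMap' K, h1]
  calc _ ≤ ∑ a ∈ D.weights, ‖D.P a i j‖ := by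
        refine (norm_sum_le _ _).trans (Finset.sum_le_sum fun a ha => ?_)
        rw [Matrix.smul_apply, norm_smul, ht a ha, one_mul]
    _ ≤ ∑ j, ∑ a ∈ D.weights, ‖D.P a i j‖ :=
        Finset.single_le_sum (f := fun j => ∑ a ∈ D.weights, ‖D.P a i j‖)
          (fun j _ => by positivity) (Finset.mem_univ j)
    _ ≤ _ := Finset.single_le_sum (f := fun i => ∑ j, ∑ a ∈ D.weights, ‖D.P a i j‖)
          (fun i _ => by positivity) (Finset.mem_univ i)

/-- On the image of `P a`, `t^m` acts by the `m`-th power of the weight value, which would be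
unbounded if its norm exceeded `1`. -/
theorem norm_weightValue_le_one_of_bounded {t : T.points k} {C : ℝ}
    (hC : ∀ (m : ℕ) i j, ‖((t : GL (Fin n) k) ^ m) i j‖ ≤ C) {a : Fin D.r → ℤ}
    (ha : a ∈ D.weights) : ‖(D.weightValue a t : K)‖ ≤ 1 := by
  have h : ∃ i j, D.P a i j ≠ 0 := by
    by_contra! h
    exact D.P_ne_zero a ha (Matrix.ext h)
  obtain ⟨i, j, hij⟩ := h
  by_contra! h1
  obtain ⟨m, hm⟩ := pow_unbounded_of_one_lt ((∑ l, C * ‖D.P a l j‖) / ‖D.P a i j‖) h1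
  rw [div_lt_iff₀ (norm_pos_iff.2 hij)] at hm
  have h2 := congrArg (· * D.P a) (D.map_coe_eq (t ^ m))
  simp only [D.sum_smul_P_mul _ ha] at h2
  have h3 := congrArg norm (congrFun (congrFun h2 i) j)
  rw [Matrix.smul_apply, norm_smul, map_pow, Units.val_pow_eq_pow_val, norm_pow,
    Matrix.mul_apply] at h3
  rw [← h3] at hm
  refine absurd hm (not_lt.2 ((norm_sum_le _ _).trans (Finset.sum_le_sum fun l _ => ?_)))
  rw [norm_mul, Matrix.map_apply, norm_algebraMap']
  exact mul_le_mul_of_nonneg_right (hC m i l) (norm_nonneg _)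

theorem mem_compactPart_of_bounded {t : T.points k} {C : ℝ}
    (hC : ∀ (m : ℕ) i j, ‖((t : GL (Fin n) k) ^ m) i j‖ ≤ C)
    (hC' : ∀ (m : ℕ) i j, ‖((t : GL (Fin n) k)⁻¹ ^ m) i j‖ ≤ C) : t ∈ D.compactPart := by
  intro a ha
  refine le_antisymm (D.norm_weightValue_le_one_of_bounded hC ha) ?_
  have h1 := D.norm_weightValue_le_one_of_bounded (t := t⁻¹) hC' ha
  rw [map_inv, Units.val_inv_eq_inv_val, norm_inv] at h1
  have h2 : 0 < ‖(D.weightValue a t : K)‖ := norm_pos_iff.2 (Units.ne_zero _)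
  exact (inv_le_one₀ h2).1 h1

theorem isCompact_compactPart [ProperSpace k] :
    IsCompact ((D.compactPart.map (T.points k).subtype : Subgroup (GL (Fin n) k)) :
      Set (GL (Fin n) k)) := by
  obtain ⟨C, hC⟩ := D.exists_bound_compactPart
  -- No continuity is known for the isomorphism `D.e`, so closedness is read off from the matrix
  -- entries: the compact part is the set of `g` all of whose positive and negative powers are
  -- bounded by `C`.
  have h1 : ((D.compactPart.map (T.points k).subtype : Subgroup (GL (Fin n) k)) :
      Set (GL (Fin n) k)) = (T.points k : Set (GL (Fin n) k)) ∩
      ⋂ (m : ℕ) (i) (j), ({g | ‖(g ^ m) i j‖ ≤ C} ∩ {g | ‖(g⁻¹ ^ m) i j‖ ≤ C}) := by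
    ext g
    simp only [Subgroup.coe_map, Subgroup.coe_subtype, Set.mem_image, Set.mem_inter_iff,
      Set.mem_iInter, Set.mem_ofPred_eq, SetLike.mem_coe]
    constructor
    · rintro ⟨t, ht, rfl⟩
      exact ⟨t.2, fun m i j => ⟨hC _ (pow_mem ht m) i j,
        hC _ (pow_mem (InvMemClass.inv_mem ht) m) i j⟩⟩
    · rintro ⟨hg, h⟩
      exact ⟨⟨g, hg⟩, D.mem_compactPart_of_bounded (fun m i j => (h m i j).1)
        (fun m i j => (h m i j).2), rfl⟩
  refine (Matrix.GeneralLinearGroup.isCompact_setOf_norm_le (k := k) (n := n) C).of_isClosed_subset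
    ?_ ?_
  · rw [h1]
    refine T.isClosed_points.inter (isClosed_iInter fun m => isClosed_iInter fun i =>
      isClosed_iInter fun j => IsClosed.inter ?_ ?_)
    · exact isClosed_le ((Matrix.GeneralLinearGroup.continuous_entry i j).comp
        (continuous_pow m)).norm continuous_const
    · exact isClosed_le ((Matrix.GeneralLinearGroup.continuous_entry i j).comp
        (continuous_inv.pow m)).norm continuous_const
  · rintro _ ⟨t, ht, rfl⟩
    exact ⟨hC t ht, hC _ (InvMemClass.inv_mem ht)⟩

theorem le_compactPart_of_isCompact {C : Subgroup (GL (Fin n) k)} (hCT : C ≤ T.points k)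
    (hC : IsCompact (C : Set (GL (Fin n) k))) :
    C ≤ D.compactPart.map (T.points k).subtype := by
  have h1 : ∀ i j, ∃ B, ∀ g ∈ C, ‖g i j‖ ≤ B := fun i j =>
    hC.exists_bound_of_continuousOn
      (Matrix.GeneralLinearGroup.continuous_entry i j).continuousOn
  choose B hB using h1
  have h2 : ∀ g ∈ C, ∀ i j, ‖g i j‖ ≤ ∑ i, ∑ j, |B i j| := fun g hg i j =>
    calc _ ≤ |B i j| := (hB i j g hg).trans (le_abs_self _)
      _ ≤ ∑ j, |B i j| := Finset.single_le_sum (f := fun j => |B i j|)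
          (fun j _ => abs_nonneg _) (Finset.mem_univ j)
      _ ≤ _ := Finset.single_le_sum (f := fun i => ∑ j, |B i j|)
          (fun i _ => by positivity) (Finset.mem_univ i)
  intro g hg
  exact ⟨⟨g, hCT hg⟩, D.mem_compactPart_of_bounded (fun m => h2 _ (pow_mem hg m))
    (fun m => h2 _ (pow_mem (InvMemClass.inv_mem hg) m)), rfl⟩

end WeightDecomposition

end LinearAlgebraicGroup

end Bounded

/-! ### The index function over `ℚ_p`: finiteness, properness and double cosets. -/

section Padic

open Filter Topology

namespace LinearAlgebraicGroup

variable {p : ℕ} [Fact p.Prime] {n : ℕ} {G T : LinearAlgebraicGroup ℚ_[p] n}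

theorem isGreatest_compactSubgroups (G : LinearAlgebraicGroup ℚ_[p] n)
    (D : (T.baseChange (PadicAlgCl p)).WeightDecomposition) : IsGreatest (G.compactSubgroups T)
      ((D.compactPart.map (T.points ℚ_[p]).subtype).subgroupOf (G.points ℚ_[p])) := by
  refine ⟨⟨?_, ?_⟩, ?_⟩
  · rintro x ⟨t, -, ht⟩
    rw [rationalPoints, Subgroup.mem_subgroupOf]
    have h := t.2
    rwa [show (t : GL (Fin n) ℚ_[p]) = x from ht] at h
  · exact G.isClosed_points.isClosedEmbedding_subtypeVal.isCompact_preimage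
      D.isCompact_compactPart
  · rintro C ⟨hCT, hC⟩ x hx
    refine D.le_compactPart_of_isCompact (C := C.map (G.points ℚ_[p]).subtype) ?_ ?_
      ⟨x, hx, rfl⟩
    · rintro _ ⟨y, hy, rfl⟩
      exact hCT hy
    · exact hC.image continuous_subtype_val

theorem maximalCompact_eq (G : LinearAlgebraicGroup ℚ_[p] n)
    (D : (T.baseChange (PadicAlgCl p)).WeightDecomposition) : G.maximalCompact T =
      (D.compactPart.map (T.points ℚ_[p]).subtype).subgroupOf (G.points ℚ_[p]) :=
  (isGreatest_compactSubgroups G D).isLUB.sSup_eq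

theorem conjInter_mem_compactSubgroups (G T : LinearAlgebraicGroup ℚ_[p] n)
    {K : Subgroup (G.points ℚ_[p])} (hK : IsCompact (K : Set (G.points ℚ_[p])))
    (g : G.points ℚ_[p]) : G.conjInter T K g ∈ G.compactSubgroups T := by
  refine ⟨inf_le_left, ?_⟩
  rw [conjInter, Subgroup.coe_inf]
  refine IsCompact.inter_left ?_ (T.isClosed_points.preimage continuous_subtype_val)
  rw [Subgroup.coe_map]
  exact hK.image (by
    change Continuous fun x => g⁻¹ * x * g⁻¹⁻¹
    fun_prop)

theorem relIndex_conjInter_ne_zero {K : Subgroup (G.points ℚ_[p])}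
    (hK : IsOpen (K : Set (G.points ℚ_[p])))
    (hM : G.maximalCompact T ∈ G.compactSubgroups T) (g : G.points ℚ_[p]) :
    (G.conjInter T K g).relIndex (G.maximalCompact T) ≠ 0 := by
  have _ : CompactSpace (G.maximalCompact T) := isCompact_iff_compactSpace.1 hM.2
  have h : IsOpen (((G.conjInter T K g).subgroupOf (G.maximalCompact T) :
      Subgroup (G.maximalCompact T)) : Set (G.maximalCompact T)) := by
    have h1 : (((G.conjInter T K g).subgroupOf (G.maximalCompact T) :
        Subgroup (G.maximalCompact T)) : Set (G.maximalCompact T)) =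
        (fun x : G.maximalCompact T => g * (x : G.points ℚ_[p]) * g⁻¹) ⁻¹' K := by
      ext x
      rw [SetLike.mem_coe, Subgroup.mem_subgroupOf, mem_conjInter]
      exact and_iff_right (hM.1 x.2)
    rw [h1]
    exact hK.preimage (by fun_prop)
  have _ := Subgroup.quotient_finite_of_isOpen _ h
  exact Subgroup.index_ne_zero_of_finite

section Operator

open scoped Matrix.Norms.Operator
open NormedSpace

theorem padicExpUnit_val_pow {𝔸 : Type*} [NormedRing 𝔸] [NormedAlgebra ℚ_[p] 𝔸]
    [CompleteSpace 𝔸] {x : 𝔸} (hx : x ∈ padicExpBall 𝔸 p) (m : ℕ) :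
    ((padicExpUnit x hx ^ m : 𝔸ˣ) : 𝔸) = exp ((m : ℚ_[p]) • x) :=
  (Units.val_pow_eq_pow_val _ _).trans (padicExp_natCast_smul hx m).symm

theorem padicExpUnit_inv_val_pow {𝔸 : Type*} [NormedRing 𝔸] [NormedAlgebra ℚ_[p] 𝔸]
    [CompleteSpace 𝔸] {x : 𝔸} (hx : x ∈ padicExpBall 𝔸 p) (m : ℕ) :
    (((padicExpUnit x hx)⁻¹ ^ m : 𝔸ˣ) : 𝔸) = exp ((m : ℚ_[p]) • -x) :=
  padicExpUnit_val_pow (neg_mem_padicExpBall hx) m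

theorem exists_coe_pow_eq_padicExp {X : Matrix (Fin n) (Fin n) ℚ_[p]}
    (hX : X ∈ padicExpBall (Matrix (Fin n) (Fin n) ℚ_[p]) p) (hXT : X ∈ T.lieAlgebra) :
    ∃ t : T.points ℚ_[p], ∀ m : ℕ,
      (((t : GL (Fin n) ℚ_[p]) ^ m : GL (Fin n) ℚ_[p]) : Matrix (Fin n) (Fin n) ℚ_[p]) =
        exp ((m : ℚ_[p]) • X) ∧
      (((t : GL (Fin n) ℚ_[p])⁻¹ ^ m : GL (Fin n) ℚ_[p]) : Matrix (Fin n) (Fin n) ℚ_[p]) =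
        exp ((m : ℚ_[p]) • -X) :=
  ⟨⟨padicExpUnit X hX, padicExpUnit_mem_points hX hXT⟩, fun m =>
    ⟨padicExpUnit_val_pow hX m, padicExpUnit_inv_val_pow hX m⟩⟩

/-- Integers have norm at most `1`, so balls around `0` are stable under them and all powers of `exp
X` stay near `1`. The bound `2` is merely a number larger than the norms of the entries of the
identity. -/
theorem exists_forall_bounded_padicExp_smul (p n : ℕ) [Fact p.Prime] :
    ∃ U ∈ 𝓝 (0 : Matrix (Fin n) (Fin n) ℚ_[p]), ∀ X ∈ U,
      X ∈ padicExpBall (Matrix (Fin n) (Fin n) ℚ_[p]) p ∧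
      ∀ (m : ℕ) ij, ‖Padic.matrixEntry ij (exp ((m : ℚ_[p]) • X))‖ ≤ 2 ∧
        ‖Padic.matrixEntry ij (exp ((m : ℚ_[p]) • -X))‖ ≤ 2 := by
  have h1 : ∀ᶠ A in 𝓝 (1 : Matrix (Fin n) (Fin n) ℚ_[p]), ∀ ij : Fin n × Fin n,
      ‖Padic.matrixEntry ij A‖ < 2 := by
    refine eventually_all.2 fun ij => ?_
    refine (Padic.matrixEntry ij).continuous.norm.continuousAt.eventually_lt
      continuousAt_const ?_
    rw [Padic.matrixEntry_apply, Matrix.one_apply]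
    split_ifs <;> simp
  have h2 := (tendsto_padicExp_zero p (Matrix (Fin n) (Fin n) ℚ_[p])).eventually h1
  obtain ⟨ε, hε, h3⟩ := Metric.eventually_nhds_iff_ball.1 h2
  refine ⟨Metric.ball 0 ε ∩ padicExpBall _ p,
    inter_mem (Metric.ball_mem_nhds _ hε) padicExpBall_mem_nhds, fun X hX => ⟨hX.2, ?_⟩⟩
  have h4 : ∀ Y : Matrix (Fin n) (Fin n) ℚ_[p], Y ∈ Metric.ball 0 ε → ∀ (m : ℕ) ij,
      ‖Padic.matrixEntry ij (exp ((m : ℚ_[p]) • Y))‖ ≤ 2 := by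
    intro Y hY m ij
    refine (h3 _ ?_ ij).le
    rw [mem_ball_zero_iff] at hY ⊢
    refine lt_of_le_of_lt ?_ hY
    rw [norm_smul]
    exact mul_le_of_le_one_left (norm_nonneg _) (by exact_mod_cast Padic.norm_int_le_one (p := p) m)
  refine fun m ij => ⟨h4 X hX.1 m ij, h4 (-X) ?_ m ij⟩
  simpa using hX.1

/-- `K_T` contains an element all of whose nontrivial powers are semisimple with the same
centralizer as `T`. -/
theorem exists_regular_mem_maximalCompact
    (D : (T.baseChange (PadicAlgCl p)).WeightDecomposition)
    (hTG : T.points ℚ_[p] ≤ G.points ℚ_[p]) : ∃ t ∈ G.maximalCompact T, ∀ m : ℕ, m ≠ 0 →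
      (∃ Q : Polynomial ℚ_[p], Q.Separable ∧
        Polynomial.aeval (((t ^ m : G.points ℚ_[p]) : GL (Fin n) ℚ_[p]) :
          Matrix (Fin n) (Fin n) ℚ_[p]) Q = 0) ∧
      ∀ g : G.points ℚ_[p], Commute g (t ^ m) → g ∈ G.centralizerPoints T := by
  obtain ⟨X, hXT, c, hc, hX⟩ := D.exists_regular_mem_lieAlgebra
  obtain ⟨U, hU, hUexp⟩ := exists_forall_bounded_padicExp_smul p n
  have h1 : Tendsto (fun j : ℕ => (p : ℚ_[p]) ^ j • X) atTop (𝓝 0) := by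
    have := (tendsto_pow_atTop_nhds_zero_of_norm_lt_one
      (Padic.norm_p_lt_one (p := p))).smul_const X
    rwa [zero_smul] at this
  -- Scaling by `p^j` brings `X` into the domain where exponentials have bounded powers; it changes
  -- neither regularity nor the centralizer.
  obtain ⟨j, hj⟩ := (h1.eventually hU).exists
  obtain ⟨hball, hbound⟩ := hUexp _ hj
  obtain ⟨t, ht⟩ := exists_coe_pow_eq_padicExp hball (T.lieAlgebra.smul_mem _ hXT)
  refine ⟨⟨t, hTG t.2⟩, ?_, fun m hm => ⟨?_, fun g hg => ?_⟩⟩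
  · rw [maximalCompact_eq G D]
    refine ⟨t, D.mem_compactPart_of_bounded (C := 2) (fun m i j => ?_) (fun m i j => ?_), rfl⟩
    · rw [(ht m).1]
      exact (hbound m (i, j)).1
    · rw [(ht m).2]
      exact (hbound m (i, j)).2
  · have h2 := D.map_coe_eq (t ^ m)
    rw [Subgroup.coe_pow] at h2 ⊢
    exact D.exists_separable_aeval_eq_zero h2
  · refine D.mem_centralizerPoints_of_commute G hc hX g ?_
    have h2 : Commute ((g : GL (Fin n) ℚ_[p]) : Matrix (Fin n) (Fin n) ℚ_[p])
        (exp ((m : ℚ_[p]) • (p : ℚ_[p]) ^ j • X)) := by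
      rw [← (ht m).1]
      have h := congrArg (fun x : G.points ℚ_[p] =>
        ((x : GL (Fin n) ℚ_[p]) : Matrix (Fin n) (Fin n) ℚ_[p])) hg.eq
      simp only [Subgroup.coe_mul, Subgroup.coe_pow, Units.val_mul] at h
      exact h
    have h3 := commute_of_commute_padicExp (smul_mem_padicExpBall
      (by exact_mod_cast Padic.norm_int_le_one (p := p) m) hball) h2
    have h4 : (m : ℚ_[p]) * (p : ℚ_[p]) ^ j ≠ 0 := mul_ne_zero (by exact_mod_cast hm)
      (pow_ne_zero _ (by exact_mod_cast (Fact.out : p.Prime).ne_zero))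
    have h5 := h3.smul_right ((m : ℚ_[p]) * (p : ℚ_[p]) ^ j)⁻¹
    rwa [smul_smul, smul_smul, mul_assoc, inv_mul_cancel₀ h4, one_smul] at h5

theorem eventually_exists_conj_mem {K : Subgroup (G.points ℚ_[p])}
    (hK : IsOpen (K : Set (G.points ℚ_[p]))) {Q : Polynomial ℚ_[p]} (hQ : Q.Separable)
    (s : G.points ℚ_[p]) (hs : Polynomial.aeval ((s : GL (Fin n) ℚ_[p]) :
      Matrix (Fin n) (Fin n) ℚ_[p]) Q = 0) :
    ∀ᶠ g : G.points ℚ_[p] in 𝓝 s, Polynomial.aeval ((g : GL (Fin n) ℚ_[p]) :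
      Matrix (Fin n) (Fin n) ℚ_[p]) Q = 0 → ∃ k ∈ K, g = k * s * k⁻¹ := by
  have hemb : IsEmbedding fun g : G.points ℚ_[p] =>
      ((g : GL (Fin n) ℚ_[p]) : Matrix (Fin n) (Fin n) ℚ_[p]) :=
    Padic.isOpenEmbedding_generalLinearGroup_val.isEmbedding.comp IsEmbedding.subtypeVal
  have h1 : (K : Set (G.points ℚ_[p])) ∈ 𝓝 1 := hK.mem_nhds K.one_mem
  rw [hemb.nhds_eq_comap] at h1
  obtain ⟨V, hV, hVK⟩ := h1
  have h2 := hemb.continuous.continuousAt.eventually (eventually_exists_conj s.2 hQ hs hV)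
  filter_upwards [h2] with g hg hgQ
  obtain ⟨k, hk, hkV, h⟩ := hg g g.2 rfl hgQ
  exact ⟨⟨k, hk⟩, hVK hkV, Subtype.ext h⟩

end Operator

theorem isClosed_setOf_aeval_eq_zero (G : LinearAlgebraicGroup ℚ_[p] n) (Q : Polynomial ℚ_[p]) :
    IsClosed {g : G.points ℚ_[p] | Polynomial.aeval ((g : GL (Fin n) ℚ_[p]) :
      Matrix (Fin n) (Fin n) ℚ_[p]) Q = 0} := by
  refine isClosed_eq (Polynomial.continuous_aeval Q |>.comp
    (Units.continuous_val.comp continuous_subtype_val)) continuous_const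

/-- A semisimple conjugacy class meets a compact open subgroup `K` in finitely many
`K`-conjugacy classes. -/
theorem exists_finite_conj {K : Subgroup (G.points ℚ_[p])}
    (hKo : IsOpen (K : Set (G.points ℚ_[p]))) (hKc : IsCompact (K : Set (G.points ℚ_[p])))
    {Q : Polynomial ℚ_[p]} (hQ : Q.Separable) {s : G.points ℚ_[p]}
    (hs : Polynomial.aeval ((s : GL (Fin n) ℚ_[p]) : Matrix (Fin n) (Fin n) ℚ_[p]) Q = 0) :
    ∃ F : Set (G.points ℚ_[p]), F.Finite ∧ ∀ g, g * s * g⁻¹ ∈ K →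
      ∃ f ∈ F, ∃ k ∈ K, Commute ((k * f)⁻¹ * g) s := by
  classical
  -- The elements of `K` killed by `Q` form a compact set, and each has a neighbourhood in which the
  -- elements killed by `Q` are `K`-conjugate to it.
  obtain ⟨t, -, ht⟩ := (hKc.inter_right (G.isClosed_setOf_aeval_eq_zero Q)).elim_nhds_subcover
    (fun x => {g : G.points ℚ_[p] | Polynomial.aeval ((g : GL (Fin n) ℚ_[p]) :
      Matrix (Fin n) (Fin n) ℚ_[p]) Q = 0 → ∃ k ∈ K, g = k * x * k⁻¹})
    (fun x hx => eventually_exists_conj_mem hKo hQ x hx.2)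
  -- Choose one conjugator `f x` for each `x` in the class of `s`; the value `1` at other `x` plays
  -- no role.
  have h1 : ∀ x : G.points ℚ_[p], ∃ f : G.points ℚ_[p], (∃ g, g * s * g⁻¹ = x) →
      f * s * f⁻¹ = x := by
    intro x
    by_cases h : ∃ g, g * s * g⁻¹ = x
    · exact h.imp fun g hg _ => hg
    · exact ⟨1, fun h' => absurd h' h⟩
  choose f hf using h1
  refine ⟨f '' t, t.finite_toSet.image f, fun g hg => ?_⟩
  have hgQ : Polynomial.aeval (((g * s * g⁻¹ : G.points ℚ_[p]) : GL (Fin n) ℚ_[p]) :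
      Matrix (Fin n) (Fin n) ℚ_[p]) Q = 0 := by
    have h2 : SemiconjBy ((g : GL (Fin n) ℚ_[p]) : Matrix (Fin n) (Fin n) ℚ_[p])
        ((s : GL (Fin n) ℚ_[p]) : Matrix (Fin n) (Fin n) ℚ_[p])
        (((g * s * g⁻¹ : G.points ℚ_[p]) : GL (Fin n) ℚ_[p]) : Matrix (Fin n) (Fin n) ℚ_[p]) := by
      have h3 : g * s = g * s * g⁻¹ * g := by group
      exact congrArg (fun x : G.points ℚ_[p] =>
        ((x : GL (Fin n) ℚ_[p]) : Matrix (Fin n) (Fin n) ℚ_[p])) h3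
    have h4 := (h2.aeval Q).eq
    rw [hs, mul_zero] at h4
    exact (Units.mul_left_eq_zero (g : GL (Fin n) ℚ_[p])).1 h4.symm
  obtain ⟨x, hxt, hx⟩ := Set.mem_iUnion₂.1 (ht ⟨hg, hgQ⟩)
  obtain ⟨k, hk, h⟩ := hx hgQ
  refine ⟨f x, ⟨x, hxt, rfl⟩, k, hk, ?_⟩
  have h5 := hf x ⟨k⁻¹ * g, by
    rw [← mul_right_inj k, ← mul_left_inj k⁻¹, ← h]
    group⟩
  have h6 : k * f x * s * (k * f x)⁻¹ = g * s * g⁻¹ := by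
    have h8 : k * f x * s * (k * f x)⁻¹ = k * (f x * s * (f x)⁻¹) * k⁻¹ := by group
    rw [h8, h5, h]
  have h7 : (k * f x)⁻¹ * (g * s * g⁻¹) * (k * f x) = s := by
    rw [← h6]
    group
  change (k * f x)⁻¹ * g * s = s * ((k * f x)⁻¹ * g)
  nth_rw 2 [← h7]
  group

/-- The sublevel sets of the index function are relatively compact. -/
theorem exists_isCompact_indexFunction_le {K : Subgroup (G.points ℚ_[p])}
    (hKo : IsOpen (K : Set (G.points ℚ_[p]))) (hKc : IsCompact (K : Set (G.points ℚ_[p])))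
    (D : (T.baseChange (PadicAlgCl p)).WeightDecomposition)
    (hTG : T.points ℚ_[p] ≤ G.points ℚ_[p]) (N : ℕ) :
    ∃ C : Set (G.points ℚ_[p] ⧸ G.centralizerPoints T), IsCompact C ∧
      ∀ x, G.indexFunction T K x ≤ N → x ∈ C := by
  obtain ⟨t, ht, h⟩ := exists_regular_mem_maximalCompact D hTG
  -- The exponent `N!` is divisible by every positive integer up to `I(g)` as soon as `I(g) ≤ N`, so
  -- this single power of `t` lies in all the groups `g⁻¹Kg` concerned. The index is nonzero, so the
  -- convention for infinite index does not interfere.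
  obtain ⟨⟨Q, hQ, hs⟩, hcent⟩ := h N.factorial N.factorial_ne_zero
  obtain ⟨F, hF, hFK⟩ := exists_finite_conj hKo hKc hQ hs
  refine ⟨⋃ f ∈ F, (fun k : G.points ℚ_[p] =>
    ((k * f : G.points ℚ_[p]) : G.points ℚ_[p] ⧸ G.centralizerPoints T)) '' K,
    hF.isCompact_biUnion fun f _ => hKc.image
      (continuous_quotient_mk'.comp (continuous_mul_const f)), fun x => ?_⟩
  refine QuotientGroup.induction_on x fun g hg => ?_
  have hM := maximalCompact_eq G D ▸ (isGreatest_compactSubgroups G D).1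
  have h1 := Subgroup.pow_mem_of_relIndex_ne_zero_of_dvd (relIndex_conjInter_ne_zero hKo hM g) ht
    (fun m hm hmI => Nat.dvd_factorial hm (hmI.trans hg))
  obtain ⟨f, hf, k, hk, hcomm⟩ := hFK g ((G.mem_conjInter T K g _).1 h1.1).2
  exact Set.mem_iUnion₂.2 ⟨f, hf, k, hk, QuotientGroup.eq.2 (hcent _ hcomm)⟩

theorem mem_range_map_of_norm_le_one {g : GL (Fin n) ℚ_[p]} (hg : ∀ i j, ‖g i j‖ ≤ 1)
    (hg' : ∀ i j, ‖g⁻¹ i j‖ ≤ 1) :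
    g ∈ (Matrix.GeneralLinearGroup.map (n := Fin n) (algebraMap ℤ_[p] ℚ_[p])).range := by
  have hinj : Function.Injective ((algebraMap ℤ_[p] ℚ_[p]).mapMatrix (m := Fin n)) :=
    fun A B h => Matrix.ext fun i j => Subtype.ext (congrFun (congrFun h i) j)
  let A : Matrix (Fin n) (Fin n) ℤ_[p] := Matrix.of fun i j => ⟨g i j, hg i j⟩
  let B : Matrix (Fin n) (Fin n) ℤ_[p] := Matrix.of fun i j => ⟨g⁻¹ i j, hg' i j⟩
  have hA : (algebraMap ℤ_[p] ℚ_[p]).mapMatrix A = g := rfl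
  have hB : (algebraMap ℤ_[p] ℚ_[p]).mapMatrix B = (g⁻¹ : GL (Fin n) ℚ_[p]) := rfl
  refine ⟨⟨A, B, hinj ?_, hinj ?_⟩, Units.ext hA⟩
  · rw [map_mul, hA, hB, map_one, Units.mul_inv]
  · rw [map_mul, hA, hB, map_one, Units.inv_mul]

theorem norm_le_one_of_norm_sub_one_lt {A : Matrix (Fin n) (Fin n) ℚ_[p]}
    (hA : ∀ ij : Fin n × Fin n,
      ‖A ij.1 ij.2 - (1 : Matrix (Fin n) (Fin n) ℚ_[p]) ij.1 ij.2‖ < 1) (i j : Fin n) :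
    ‖A i j‖ ≤ 1 := by
  have h := Padic.nonarchimedean (A i j - (1 : Matrix (Fin n) (Fin n) ℚ_[p]) i j)
    ((1 : Matrix (Fin n) (Fin n) ℚ_[p]) i j)
  rw [sub_add_cancel] at h
  refine h.trans (max_le (hA (i, j)).le ?_)
  rw [Matrix.one_apply]
  split_ifs <;> simp

theorem isOpen_integralPoints (G : LinearAlgebraicGroup ℚ_[p] n) :
    IsOpen (G.integralPoints : Set (G.points ℚ_[p])) := by
  refine Subgroup.isOpen_of_mem_nhds _ (g := 1) ?_
  have h1 : ∀ᶠ g : G.points ℚ_[p] in 𝓝 1, ∀ ij : Fin n × Fin n,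
      ‖((g : GL (Fin n) ℚ_[p]) : Matrix (Fin n) (Fin n) ℚ_[p]) ij.1 ij.2 -
        (1 : Matrix (Fin n) (Fin n) ℚ_[p]) ij.1 ij.2‖ < 1 := by
    refine eventually_all.2 fun ij => ContinuousAt.eventually_lt ?_ continuousAt_const (by simp)
    exact (((Matrix.GeneralLinearGroup.continuous_entry ij.1 ij.2).comp
      continuous_subtype_val).sub continuous_const).norm.continuousAt
  filter_upwards [h1, (continuous_inv.tendsto' (1 : G.points ℚ_[p]) 1 inv_one).eventually h1]
    with g hg hg'
  refine mem_range_map_of_norm_le_one (fun i j => ?_) (fun i j => ?_)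
  · exact norm_le_one_of_norm_sub_one_lt hg i j
  · exact norm_le_one_of_norm_sub_one_lt hg' i j

/-- The `U`-orbits on `Γ ⧸ H` are open, so finitely many cover `C`, and each orbit is one double
coset. -/
theorem finite_image_doubleCoset_of_subset_isCompact {Γ : Type*} [Group Γ] [TopologicalSpace Γ]
    [IsTopologicalGroup Γ] (U H : Subgroup Γ) (hU : IsOpen (U : Set Γ)) {C : Set (Γ ⧸ H)}
    (hC : IsCompact C) {W : Set (Γ ⧸ H)} (hW : W ⊆ C) :
    (DoubleCoset.mk U H '' ((fun g : Γ => (g : Γ ⧸ H)) ⁻¹' W)).Finite := by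
  have h1 : ∀ g : Γ, IsOpen ((fun u : Γ => ((u * g : Γ) : Γ ⧸ H)) '' U) := fun g =>
    (QuotientGroup.isOpenMap_coe.comp (isOpenMap_mul_right g)) _ hU
  obtain ⟨t, ht⟩ := hC.elim_finite_subcover _ h1 (fun x _ =>
    QuotientGroup.induction_on x fun g => Set.mem_iUnion.2 ⟨g, 1, U.one_mem, by simp⟩)
  refine (t.finite_toSet.image (DoubleCoset.mk U H)).subset ?_
  rintro _ ⟨g, hg, rfl⟩
  obtain ⟨a, hat, u, hu, hug⟩ := Set.mem_iUnion₂.1 (ht (hW hg))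
  exact ⟨a, hat, (DoubleCoset.eq U H a g).2
    ⟨u, hu, (u * a)⁻¹ * g, QuotientGroup.eq.1 hug, by group⟩⟩

end LinearAlgebraicGroup

end Padic

theorem mainTheorem8 (p : ℕ) [Fact p.Prime] (n : ℕ)
    (G T : LinearAlgebraicGroup ℚ_[p] n)
    (hG : G.IsReductive)
    (hTG : T.IsSubgroupOf G) (hT : T.IsTorus)
    (hT_nontrivial : T.points (AlgebraicClosure ℚ_[p]) ≠ ⊥)
    (K : Subgroup (G.points ℚ_[p]))
    (hK_open : IsOpen (K : Set (G.points ℚ_[p])))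
    (hK_compact : IsCompact (K : Set (G.points ℚ_[p]))) :
    -- `K_T` is the maximal compact subgroup of `T(ℚ_p)`
    IsGreatest (G.compactSubgroups T) (G.maximalCompact T) ∧
    -- `T(ℚ_p) ∩ g⁻¹Kg` is a subgroup of `K_T` of finite index
    (∀ g : G.points ℚ_[p], G.conjInter T K g ≤ G.maximalCompact T ∧
      (G.conjInter T K g).relIndex (G.maximalCompact T) ≠ 0) ∧
    -- `I(g) → ∞` as `g → ∞` in `G(ℚ_p) / H(ℚ_p)`
    Filter.Tendsto (G.indexFunction T K)
      (Filter.cocompact (G.points ℚ_[p] ⧸ G.centralizerPoints T)) Filter.atTop ∧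
    -- sets on which `I` is bounded have finite image in `G(ℤ_p) \ G(ℚ_p) / H(ℚ_p)`
    (∀ W : Set (G.points ℚ_[p] ⧸ G.centralizerPoints T),
      BddAbove (G.indexFunction T K '' W) →
      (DoubleCoset.mk G.integralPoints (G.centralizerPoints T) ''
        ((fun g : G.points ℚ_[p] => (g : G.points ℚ_[p] ⧸ G.centralizerPoints T)) ⁻¹' W)).Finite)
    := by
  -- `PadicAlgCl p` is the algebraic closure of `ℚ_[p]` with the extended p-adic norm, so the
  -- weights have absolute values.
  obtain ⟨D⟩ : Nonempty (T.baseChange (PadicAlgCl p)).WeightDecomposition :=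
    hT.nonempty_weightDecomposition
  have hgr : IsGreatest (G.compactSubgroups T) (G.maximalCompact T) := by
    rw [LinearAlgebraicGroup.maximalCompact_eq G D]
    exact LinearAlgebraicGroup.isGreatest_compactSubgroups G D
  refine ⟨hgr, fun g => ⟨hgr.2 (G.conjInter_mem_compactSubgroups T hK_compact g),
    LinearAlgebraicGroup.relIndex_conjInter_ne_zero hK_open hgr.1 g⟩, ?_, fun W hW => ?_⟩
  · refine Filter.tendsto_atTop.2 fun N => Filter.mem_cocompact.2 ?_
    obtain ⟨C, hC, h⟩ := LinearAlgebraicGroup.exists_isCompact_indexFunction_le hK_open hK_compact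
      D (hTG ℚ_[p]) N
    exact ⟨C, hC, fun x hx => (le_total _ _).resolve_left fun hle => hx (h x hle)⟩
  · obtain ⟨N, hN⟩ := hW
    obtain ⟨C, hC, h⟩ := LinearAlgebraicGroup.exists_isCompact_indexFunction_le hK_open hK_compact
      D (hTG ℚ_[p]) N
    exact LinearAlgebraicGroup.finite_image_doubleCoset_of_subset_isCompact _ _
      G.isOpen_integralPoints hC fun x hx => h x (hN ⟨x, hx, rfl⟩)
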